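/- Let $d,d'\ge 1$, and let $\mathcal T:\mathcal M_d(\mathbb C)\to\mathcal M_d(\mathbb C)$ and $\mathcal S:\mathcal M_{d'}(\mathbb C)\to\mathcal M_{d'}(\mathbb C)$ be quantum channels, i.e. completely positive trace preserving linear maps. For a channel $\mathcal T$ on $\mathcal M_d(\mathbb C)$, $\delta\in[0,1)$ and $D\ge 1$, a channel $\mathcal E:\mathcal M_D(\mathbb C)\to\mathcal M_d(\mathbb C)$ is a $(D,\delta)$ classical code for $\mathcal T$ if there is a channel $\mathcal R:\mathcal M_d(\mathbb C)\to\mathcal M_D(\mathbb C)$ with $$\frac1D\sum_{i=1}^D\langle i|\,(\mathcal R\circ\mathcal T\circ\mathcal E)(|i\rangle\langle i|)\,|i\rangle\ge 1-\delta ,$$ and a $(D,\delta)$ quantum code for $\mathcal T$ if there is such an $\mathcal R$ with $$\langle\Phi^+|\,\bigl(\mathrm{id}\otimes(\mathcal R\circ\mathcal T\circ\mathcal E)\bigr)(|\Phi^+\rangle\langle\Phi^+|)\,|\Phi^+\rangle\ge 1-\delta,\qquad |\Phi^+\rangle=\frac1{\sqrt D}\sum_{i=1}^D|i\rangle\otimes|i\rangle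 .$$ Let $C_\delta(\mathcal T)$ and $Q_\delta(\mathcal T)$ be the suprema of $\log_2 D$ over all $(D,\delta)$ classical, respectively quantum, codes for $\mathcal T$, and put $$C_\delta^\infty(\mathcal T)=\lim_{t\to\infty}C_\delta(\mathcal T^t),\qquad Q_\delta^\infty(\mathcal T)=\lim_{t\to\infty}Q_\delta(\mathcal T^t).$$ Let $\chi_{\mathcal T}=\operatorname{span}\{X\in\mathcal M_d(\mathbb C):\mathcal T(X)=\lambda X\text{ for some }\lambda\in\mathbb C\text{ with }|\lambda|=1\}$ be the peripheral subspace of $\mathcal T$. Then for $\delta=0$ the limits defining the infinite-time classical and quantum capacities of $\mathcal T$, $\mathcal S$ and $\mathcal T\otimes\mathcal S$ exist and are finite, the infinite-time zero-error capacities are additive, $$C_0^\infty(\mathcal T\otimes\mathcal S)=C_0^\infty(\mathcal T)+C_0^\infty(\mathcal S),\qquad Q_0^\infty(\mathcal T\otimes\mathcal S)=Q_0^\infty(\mathcal T)+Q_0^\infty(\mathcal S),$$ and $\chi_{\mathcal T\otimes\mathcal S}=\chi_{\mathcal T}\otimes\chi_{\mathcal S}$. -/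

import Mathlib

open Filter Topology
open scoped Kronecker ComplexOrder

noncomputable section

namespace InfiniteTime

/-- The tensor product `T ⊗ S` of two linear maps between matrix algebras, where
`M_n ⊗ M_m` is identified with the matrices indexed by `n × m` via the Kronecker product. -/
def tensorMap {n n' m m' : Type*} [Fintype n] [DecidableEq n] [Fintype n'] [DecidableEq n']
    [Fintype m] [DecidableEq m] [Fintype m'] [DecidableEq m']
    (T : Matrix n n ℂ →ₗ[ℂ] Matrix n' n' ℂ) (S : Matrix m m ℂ →ₗ[ℂ] Matrix m' m' ℂ) :
    Matrix (n × m) (n × m) ℂ →ₗ[ℂ] Matrix (n' × m') (n' × m') ℂ :=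
  (kroneckerLinearEquiv n' n' m' m' ℂ).toLinearMap ∘ₗ
    TensorProduct.map T S ∘ₗ (kroneckerLinearEquiv n n m m ℂ).symm.toLinearMap

theorem tensorMap_kronecker {n n' m m' : Type*} [Fintype n] [DecidableEq n] [Fintype n']
    [DecidableEq n'] [Fintype m] [DecidableEq m] [Fintype m'] [DecidableEq m']
    (T : Matrix n n ℂ →ₗ[ℂ] Matrix n' n' ℂ) (S : Matrix m m ℂ →ₗ[ℂ] Matrix m' m' ℂ)
    (A : Matrix n n ℂ) (B : Matrix m m ℂ) :
    tensorMap T S (A ⊗ₖ B) = T A ⊗ₖ S B := by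
  simp [tensorMap]

/-- Complete positivity: `id_k ⊗ T` maps positive semidefinite matrices to positive
semidefinite matrices, for every `k`. -/
def IsCompletelyPositive {n m : Type*} [Fintype n] [DecidableEq n] [Fintype m] [DecidableEq m]
    (T : Matrix n n ℂ →ₗ[ℂ] Matrix m m ℂ) : Prop :=
  ∀ (k : ℕ) (X : Matrix (Fin k × n) (Fin k × n) ℂ), X.PosSemidef →
    (tensorMap (LinearMap.id : Matrix (Fin k) (Fin k) ℂ →ₗ[ℂ] Matrix (Fin k) (Fin k) ℂ)
      T X).PosSemidef

/-- A quantum channel: a completely positive, trace preserving linear map. -/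
structure IsChannel {n m : Type*} [Fintype n] [DecidableEq n] [Fintype m] [DecidableEq m]
    (T : Matrix n n ℂ →ₗ[ℂ] Matrix m m ℂ) : Prop where
  completelyPositive : IsCompletelyPositive T
  tracePreserving : ∀ X : Matrix n n ℂ, (T X).trace = X.trace

/-- The average fidelity over the basis states, `(1/D) ∑ i, ⟨i| F(|i⟩⟨i|) |i⟩`. -/
def averageFidelity {D : ℕ} (F : Matrix (Fin D) (Fin D) ℂ →ₗ[ℂ] Matrix (Fin D) (Fin D) ℂ) : ℝ :=
  (1 / (D : ℝ)) * ∑ i : Fin D, (F (Matrix.single i i 1) i i).re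

/-- The maximally entangled unit vector `(1/√D) ∑ i, |i⟩ ⊗ |i⟩`. -/
def maxEntangled (D : ℕ) : Fin D × Fin D → ℂ :=
  fun p => if p.1 = p.2 then ((1 / Real.sqrt D : ℝ) : ℂ) else 0

/-- The entanglement fidelity `⟨Φ⁺| (id ⊗ F)(|Φ⁺⟩⟨Φ⁺|) |Φ⁺⟩`. -/
def entanglementFidelity {D : ℕ}
    (F : Matrix (Fin D) (Fin D) ℂ →ₗ[ℂ] Matrix (Fin D) (Fin D) ℂ) : ℝ :=
  (star (maxEntangled D) ⬝ᵥ
    (Matrix.mulVec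
      (tensorMap (LinearMap.id : Matrix (Fin D) (Fin D) ℂ →ₗ[ℂ] Matrix (Fin D) (Fin D) ℂ) F
        (Matrix.vecMulVec (maxEntangled D) (star (maxEntangled D))))
      (maxEntangled D))).re

section Capacities

variable {n : Type*} [Fintype n] [DecidableEq n]

/-- `E` is a `(D, δ)` classical code for `T`. -/
def IsClassicalCode (T : Module.End ℂ (Matrix n n ℂ)) (δ : ℝ) {D : ℕ}
    (E : Matrix (Fin D) (Fin D) ℂ →ₗ[ℂ] Matrix n n ℂ) : Prop :=
  IsChannel E ∧ ∃ R : Matrix n n ℂ →ₗ[ℂ] Matrix (Fin D) (Fin D) ℂ,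
    IsChannel R ∧ 1 - δ ≤ averageFidelity (R ∘ₗ T ∘ₗ E)

/-- `E` is a `(D, δ)` quantum code for `T`. -/
def IsQuantumCode (T : Module.End ℂ (Matrix n n ℂ)) (δ : ℝ) {D : ℕ}
    (E : Matrix (Fin D) (Fin D) ℂ →ₗ[ℂ] Matrix n n ℂ) : Prop :=
  IsChannel E ∧ ∃ R : Matrix n n ℂ →ₗ[ℂ] Matrix (Fin D) (Fin D) ℂ,
    IsChannel R ∧ 1 - δ ≤ entanglementFidelity (R ∘ₗ T ∘ₗ E)

/-- The one-shot classical capacity `C_δ(T)`: the supremum of `log₂ D` over all `(D, δ)`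
classical codes with `D ≥ 1`. -/
def classicalCapacity (δ : ℝ) (T : Module.End ℂ (Matrix n n ℂ)) : EReal :=
  ⨆ (D : ℕ) (_ : 1 ≤ D) (E : Matrix (Fin D) (Fin D) ℂ →ₗ[ℂ] Matrix n n ℂ)
    (_ : IsClassicalCode T δ E), ((Real.logb 2 D : ℝ) : EReal)

/-- The one-shot quantum capacity `Q_δ(T)`: the supremum of `log₂ D` over all `(D, δ)`
quantum codes with `D ≥ 1`. -/
def quantumCapacity (δ : ℝ) (T : Module.End ℂ (Matrix n n ℂ)) : EReal :=
  ⨆ (D : ℕ) (_ : 1 ≤ D) (E : Matrix (Fin D) (Fin D) ℂ →ₗ[ℂ] Matrix n n ℂ)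
    (_ : IsQuantumCode T δ E), ((Real.logb 2 D : ℝ) : EReal)

/-- The infinite-time classical capacity `C_δ^∞(T) = lim_{t → ∞} C_δ(T^t)`. The value is
meaningful when the limit exists. -/
def infClassicalCapacity (δ : ℝ) (T : Module.End ℂ (Matrix n n ℂ)) : EReal :=
  limUnder atTop (fun t : ℕ => classicalCapacity δ (T ^ t))

/-- The infinite-time quantum capacity `Q_δ^∞(T) = lim_{t → ∞} Q_δ(T^t)`. The value is
meaningful when the limit exists. -/
def infQuantumCapacity (δ : ℝ) (T : Module.End ℂ (Matrix n n ℂ)) : EReal :=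
  limUnder atTop (fun t : ℕ => quantumCapacity δ (T ^ t))

/-- The peripheral subspace: the span of the eigenvectors with eigenvalue of modulus one. -/
def peripheralSubspace (T : Module.End ℂ (Matrix n n ℂ)) : Submodule ℂ (Matrix n n ℂ) :=
  Submodule.span ℂ {X | ∃ z : ℂ, ‖z‖ = 1 ∧ T X = z • X}

end Capacities

end InfiniteTime

end

/-!
Let `P` be an idempotent limit of powers of a channel `T` (the projection onto the peripheral
subspace). Every power of `T` divides `P`, and the set of channels is compact, so a zero-error code
of size `D` exists for all powers of `T` exactly when one exists for `P`
(`IsPeripheralLimit.hasCode`, `IsPeripheralLimit.exists_mul_pow`). Code sizes are bounded and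
decrease along the powers of `T`, hence the zero-error capacities of `T ^ t` are eventually constant
and equal to those of `P`. If the powers of `T` and `S` converge to `P` and `Q` along the same
exponents, those of `T ⊗ S` converge to `P ⊗ Q`. It remains to compute the capacities of idempotent
channels by a quantity which is multiplicative under tensor products.

Let `Φ` be the adjoint of `P`. Its fixed points form a finite-dimensional *-algebra `W` for the
Choi–Effros product `a ∘ b = Φ (a b)`. Vanishing of the Schwarz defect shows that fixed points
commute past the Kraus operators of `P`, up to multiplication by another Kraus operator
(`IsRetraction.mul_mul_eq`); associativity follows, and so does the fact that on the support of `P`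
the product `a ∘ b` acts like the matrix product (`IsRetraction.krausDual_mul_kraus`). The trace is
a faithful positive functional on `W`, and therefore the unit of `W` is a sum of orthogonal minimal
projections `e i` (`IsFaithfulPositive.exists_minimalDecomposition`). Two of them are linked when
`e i ∘ W ∘ e j ≠ 0`.

* The largest classical code has as many letters as there are `e i`. The `e i` themselves are a
  measurement for such a code. Conversely, the output states `τ j` of a code for `P` determine left
  ideals `{a | a * τ j = 0}` of `W` which are separated by the effects of the decoder, and
  `IsMinimalDecomposition.card_le_of_separated` bounds the number of such ideals.
* The largest quantum code has the size of the largest class of linked `e i`. The partial isometries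
  between linked projections give matrix units, and hence a code. Conversely, for a code of size `D`
  with decoder `R`, equality in the Schwarz inequality turns `a ↦ E† (Φ a) v` into a map
  intertwining left multiplication by `Φ (R† x)` with `x`, which is surjective onto `ℂ ^ D` already on some
  minimal left ideal `W ∘ e i` (`IsMinimalDecomposition.exists_le_card_linked`).

The algebra of `P ⊗ Q` is spanned by elementary tensors (`FixedAlgebra.isAlgebraTensor`). The
products `e i ⊗ f j` are minimal projections which add up to the unit, and their classes are the products of
classes, so that both quantities are multiplicative.

For the peripheral subspaces, the generalised eigenspaces show that the range of `P` is contained in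
the peripheral subspace of `T`, and an eigenvector of `T ⊗ S` with unimodular eigenvalue lies in the
range of `P ⊗ Q`.
-/

set_option linter.unusedSectionVars false

namespace InfiniteTime

/-! ### Kraus families and Choi's theorem -/

theorem exists_eq_conjTranspose_mul_self {n : Type*} [Fintype n] [DecidableEq n]
    {A : Matrix n n ℂ} (hA : A.PosSemidef) : ∃ B : Matrix n n ℂ, A = B.conjTranspose * B := by
  open scoped MatrixOrder Matrix.Norms.L2Operator in
  exact CStarAlgebra.nonneg_iff_eq_star_mul_self.mp hA.nonneg

section Kraus

variable {n m p q κ μ : Type*} [Fintype n] [DecidableEq n] [Fintype m] [DecidableEq m]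
  [Fintype p] [DecidableEq p] [Fintype q] [DecidableEq q] [Fintype κ] [Fintype μ]

/-- The map `X ↦ ∑ i, K i * X * (K i)ᴴ` with Kraus operators `K`. -/
def kraus (K : κ → Matrix m n ℂ) : Matrix n n ℂ →ₗ[ℂ] Matrix m m ℂ where
  toFun X := ∑ i, K i * X * (K i).conjTranspose
  map_add' X Y := by simp [Matrix.mul_add, Matrix.add_mul, Finset.sum_add_distrib]
  map_smul' c X := by simp [Finset.smul_sum]

/-- The map `Y ↦ ∑ i, (K i)ᴴ * Y * K i`, adjoint to `kraus K` for the trace pairing. -/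
def krausDual (K : κ → Matrix m n ℂ) : Matrix m m ℂ →ₗ[ℂ] Matrix n n ℂ :=
  kraus fun i => (K i).conjTranspose

theorem kraus_apply (K : κ → Matrix m n ℂ) (X : Matrix n n ℂ) :
    kraus K X = ∑ i, K i * X * (K i).conjTranspose := rfl

theorem krausDual_apply (K : κ → Matrix m n ℂ) (X : Matrix m m ℂ) :
    krausDual K X = ∑ i, (K i).conjTranspose * X * K i := by
  simp [kraus_apply, krausDual]

theorem kraus_conjTranspose (K : κ → Matrix m n ℂ) (X : Matrix n n ℂ) :
    kraus K X.conjTranspose = (kraus K X).conjTranspose := by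
  simp [kraus_apply, Matrix.conjTranspose_sum, Matrix.mul_assoc]

theorem kraus_posSemidef (K : κ → Matrix m n ℂ) {X : Matrix n n ℂ} (hX : X.PosSemidef) :
    (kraus K X).PosSemidef :=
  Matrix.posSemidef_sum _ fun i _ => hX.mul_mul_conjTranspose_same (K i)

theorem trace_mul_kraus (K : κ → Matrix m n ℂ) (Y : Matrix m m ℂ) (X : Matrix n n ℂ) :
    (Y * kraus K X).trace = (krausDual K Y * X).trace := by
  rw [krausDual_apply, kraus_apply, Matrix.mul_sum, Matrix.sum_mul, Matrix.trace_sum,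
    Matrix.trace_sum]
  refine Finset.sum_congr rfl fun i _ => ?_
  rw [← Matrix.mul_assoc, Matrix.trace_mul_comm, ← Matrix.mul_assoc, ← Matrix.mul_assoc]

theorem trace_kraus (K : κ → Matrix m n ℂ)
    (hK : ∑ i, (K i).conjTranspose * K i = 1) (X : Matrix n n ℂ) :
    (kraus K X).trace = X.trace := by
  have := trace_mul_kraus K 1 X
  rw [one_mul, krausDual_apply] at this
  simpa [hK] using this

theorem kraus_comp (K : κ → Matrix m n ℂ) (L : μ → Matrix p m ℂ) :
    kraus L ∘ₗ kraus K = kraus (fun i : μ × κ => L i.1 * K i.2) := by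
  ext1 X
  simp only [LinearMap.comp_apply, kraus_apply, Fintype.sum_prod_type, Matrix.mul_sum,
    Matrix.sum_mul, Matrix.conjTranspose_mul, Matrix.mul_assoc]

theorem sum_conjTranspose_mul_self_comp (K : κ → Matrix m n ℂ) (L : μ → Matrix p m ℂ)
    (hK : ∑ i, (K i).conjTranspose * K i = 1) (hL : ∑ i, (L i).conjTranspose * L i = 1) :
    ∑ i : μ × κ, (L i.1 * K i.2).conjTranspose * (L i.1 * K i.2) = 1 := by
  rw [Fintype.sum_prod_type_right]
  have : ∀ j : κ, ∑ i : μ, (L i * K j).conjTranspose * (L i * K j)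
      = (K j).conjTranspose * K j := by
    intro j
    have h := congrArg (fun Z => (K j).conjTranspose * Z * K j) hL
    simpa [Matrix.mul_sum, Matrix.sum_mul, Matrix.mul_assoc] using h
  simp only [this, hK]

theorem linearMap_ext_kronecker {V : Type*} [AddCommMonoid V] [Module ℂ V]
    {F G : Matrix (n × m) (n × m) ℂ →ₗ[ℂ] V}
    (h : ∀ A B, F (A ⊗ₖ B) = G (A ⊗ₖ B)) : F = G := by
  ext1 X
  obtain ⟨x, rfl⟩ := (kroneckerLinearEquiv n n m m ℂ).surjective X
  induction x using TensorProduct.induction_on with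
  | zero => simp
  | tmul a b => exact h a b
  | add a b ha hb => simp only [map_add, ha, hb]

theorem tensorMap_kraus (K : κ → Matrix p n ℂ) (L : μ → Matrix q m ℂ) :
    tensorMap (kraus K) (kraus L) = kraus (fun i : κ × μ => K i.1 ⊗ₖ L i.2) := by
  refine linearMap_ext_kronecker fun A B => ?_
  rw [tensorMap_kronecker, kraus_apply, kraus_apply, kraus_apply, Fintype.sum_prod_type]
  simp only [Matrix.conjTranspose_kronecker, ← Matrix.mul_kronecker_mul]
  ext ⟨i, j⟩ ⟨i', j'⟩
  simp [Matrix.sum_apply, Finset.sum_mul_sum]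

theorem sum_conjTranspose_mul_self_kronecker (K : κ → Matrix p n ℂ) (L : μ → Matrix q m ℂ)
    (hK : ∑ i, (K i).conjTranspose * K i = 1) (hL : ∑ i, (L i).conjTranspose * L i = 1) :
    ∑ i : κ × μ, (K i.1 ⊗ₖ L i.2).conjTranspose * (K i.1 ⊗ₖ L i.2) = 1 := by
  rw [Fintype.sum_prod_type, ← Matrix.one_kronecker_one (α := ℂ), ← hK, ← hL]
  simp only [Matrix.conjTranspose_kronecker, ← Matrix.mul_kronecker_mul]
  ext ⟨i, j⟩ ⟨i', j'⟩
  simp [Matrix.sum_apply, Finset.sum_mul_sum]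

theorem kraus_one_eq_id : kraus (fun _ : Unit => (1 : Matrix n n ℂ)) = LinearMap.id := by
  ext1 X; simp [kraus_apply]

theorem isCompletelyPositive_kraus (K : κ → Matrix m n ℂ) : IsCompletelyPositive (kraus K) := by
  intro k X hX
  rw [← kraus_one_eq_id, tensorMap_kraus]
  exact kraus_posSemidef _ hX

theorem isChannel_kraus (K : κ → Matrix m n ℂ) (hK : ∑ i, (K i).conjTranspose * K i = 1) :
    IsChannel (kraus K) :=
  ⟨isCompletelyPositive_kraus K, trace_kraus K hK⟩

/-- Entrywise description of `id ⊗ T`: `T` acts on the blocks of the matrix. -/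
theorem tensorMap_id_apply (T : Matrix n n ℂ →ₗ[ℂ] Matrix m m ℂ)
    (X : Matrix (p × n) (p × n) ℂ) (a b : p) (i j : m) :
    tensorMap (LinearMap.id : Matrix p p ℂ →ₗ[ℂ] Matrix p p ℂ) T X (a, i) (b, j)
      = T (X.submatrix (fun x => (a, x)) (fun x => (b, x))) i j := by
  let F : Matrix (p × n) (p × n) ℂ →ₗ[ℂ] ℂ :=
    Matrix.entryLinearMap ℂ ℂ (a, i) (b, j) ∘ₗ
      tensorMap (LinearMap.id : Matrix p p ℂ →ₗ[ℂ] Matrix p p ℂ) T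
  let G : Matrix (p × n) (p × n) ℂ →ₗ[ℂ] ℂ :=
    Matrix.entryLinearMap ℂ ℂ i j ∘ₗ T ∘ₗ
      { toFun := fun X => X.submatrix (fun x => (a, x)) (fun x => (b, x))
        map_add' := fun _ _ => rfl
        map_smul' := fun _ _ => rfl }
  have : F = G := by
    refine linearMap_ext_kronecker fun A B => ?_
    have hs : (A ⊗ₖ B).submatrix (fun x => (a, x)) (fun x => (b, x)) = A a b • B := by
      ext x y; simp
    have hG : G (A ⊗ₖ B) = T ((A ⊗ₖ B).submatrix (fun x => (a, x)) (fun x => (b, x))) i j := rfl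
    rw [hG, hs]
    simp [F, tensorMap_kronecker]
  exact LinearMap.congr_fun this X

/-- **Choi's theorem**: a completely positive map has Kraus operators, obtained by factoring its
Choi matrix. -/
theorem IsCompletelyPositive.exists_kraus {T : Matrix n n ℂ →ₗ[ℂ] Matrix m m ℂ}
    (hT : IsCompletelyPositive T) :
    ∃ K : (Fin (Fintype.card n) × m) → Matrix m n ℂ, T = kraus K := by
  set k := Fintype.card n
  let f : n ≃ Fin k := Fintype.equivFin n
  let ω : Fin k × n → ℂ := fun x => if x.1 = f x.2 then 1 else 0
  have hC := hT k _ (Matrix.posSemidef_vecMulVec_self_star ω)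
  obtain ⟨B, hB⟩ := exists_eq_conjTranspose_mul_self hC
  have hsub : ∀ a b : n, (Matrix.vecMulVec ω (star ω)).submatrix (fun x => (f a, x))
      (fun x => (f b, x)) = Matrix.single a b 1 := by
    intro a b
    ext x y
    simp only [Matrix.submatrix_apply, Matrix.vecMulVec_apply, Pi.star_apply, ω,
      EmbeddingLike.apply_eq_iff_eq, Matrix.single_apply]
    by_cases h1 : a = x <;> by_cases h2 : b = y <;> simp [h1, h2]
  refine ⟨fun r => Matrix.of fun i x => star (B r (f x, i)), ?_⟩
  refine Matrix.ext_linearMap (R := ℂ) fun a b => LinearMap.ext fun c => ?_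
  have key : T (Matrix.single a b 1) =
      kraus (fun r => Matrix.of fun i x => star (B r (f x, i))) (Matrix.single a b 1) := by
    ext i j
    have h1 := congrFun (congrFun hB (f a, i)) (f b, j)
    rw [tensorMap_id_apply, hsub] at h1
    rw [h1, Matrix.mul_apply, kraus_apply, Matrix.sum_apply]
    refine Finset.sum_congr rfl fun r _ => ?_
    simp [Matrix.mul_apply, Matrix.single_apply, ite_and]
  have hc : Matrix.single a b c = c • Matrix.single a b (1 : ℂ) := by simp
  simp only [LinearMap.comp_apply, Matrix.singleLinearMap_apply, hc]
  rw [map_smul, map_smul, key]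

theorem trace_mul_right_injective {A B : Matrix n n ℂ}
    (h : ∀ X : Matrix n n ℂ, (A * X).trace = (B * X).trace) : A = B := by
  ext i j
  simpa [Matrix.trace_mul_single] using h (Matrix.single j i 1)

theorem sum_conjTranspose_mul_self_eq_one (K : κ → Matrix m n ℂ)
    (h : ∀ X : Matrix n n ℂ, (kraus K X).trace = X.trace) :
    ∑ i, (K i).conjTranspose * K i = 1 := by
  refine trace_mul_right_injective fun X => ?_
  have := trace_mul_kraus K 1 X
  rw [one_mul, h, krausDual_apply] at this
  simpa using this.symm

theorem IsChannel.exists_kraus {T : Matrix n n ℂ →ₗ[ℂ] Matrix m m ℂ} (hT : IsChannel T) :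
    ∃ K : (Fin (Fintype.card n) × m) → Matrix m n ℂ,
      T = kraus K ∧ ∑ i, (K i).conjTranspose * K i = 1 := by
  obtain ⟨K, rfl⟩ := hT.1.exists_kraus
  exact ⟨K, rfl, sum_conjTranspose_mul_self_eq_one K hT.2⟩

theorem IsChannel.comp {T : Matrix n n ℂ →ₗ[ℂ] Matrix m m ℂ}
    {S : Matrix m m ℂ →ₗ[ℂ] Matrix p p ℂ} (hS : IsChannel S) (hT : IsChannel T) :
    IsChannel (S ∘ₗ T) := by
  obtain ⟨K, rfl, hK⟩ := hT.exists_kraus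
  obtain ⟨L, rfl, hL⟩ := hS.exists_kraus
  rw [kraus_comp]
  exact isChannel_kraus _ (sum_conjTranspose_mul_self_comp K L hK hL)

theorem isChannel_id : IsChannel (LinearMap.id : Matrix n n ℂ →ₗ[ℂ] Matrix n n ℂ) := by
  rw [← kraus_one_eq_id]
  exact isChannel_kraus _ (by simp)

theorem IsChannel.pow {T : Module.End ℂ (Matrix n n ℂ)} (hT : IsChannel T) (t : ℕ) :
    IsChannel (T ^ t) := by
  induction t with
  | zero => exact isChannel_id
  | succ t ih => exact ih.comp hT

theorem IsChannel.tensorMap {T : Matrix n n ℂ →ₗ[ℂ] Matrix p p ℂ}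
    {S : Matrix m m ℂ →ₗ[ℂ] Matrix q q ℂ} (hT : IsChannel T) (hS : IsChannel S) :
    IsChannel (tensorMap T S) := by
  obtain ⟨K, rfl, hK⟩ := hT.exists_kraus
  obtain ⟨L, rfl, hL⟩ := hS.exists_kraus
  rw [tensorMap_kraus]
  exact isChannel_kraus _ (sum_conjTranspose_mul_self_kronecker K L hK hL)

theorem IsChannel.posSemidef {T : Matrix n n ℂ →ₗ[ℂ] Matrix m m ℂ} (hT : IsChannel T)
    {X : Matrix n n ℂ} (hX : X.PosSemidef) : (T X).PosSemidef := by
  obtain ⟨K, rfl, -⟩ := hT.exists_kraus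
  exact kraus_posSemidef K hX

end Kraus

/-! ### Minimal projections in finite-dimensional *-algebras -/

section StarAlgebra

variable {A : Type*} [Ring A] [Algebra ℂ A] [StarRing A] [StarModule ℂ A]

/-- A linear functional which is strictly positive on the elements `star a * a` with `a ≠ 0`. -/
def IsFaithfulPositive (φ : A →ₗ[ℂ] ℂ) : Prop := ∀ a : A, a ≠ 0 → 0 < φ (star a * a)

theorem IsFaithfulPositive.eq_zero {φ : A →ₗ[ℂ] ℂ} (hφ : IsFaithfulPositive φ) {a : A}
    (h : star a * a = 0) : a = 0 := by
  by_contra ha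
  have := hφ a ha
  simp [h] at this

/-- If `star x * x = c • e` with `e` a nonzero projection and `x ≠ 0`, then `c` is positive. -/
theorem IsFaithfulPositive.pos_of_smul {φ : A →ₗ[ℂ] ℂ} (hφ : IsFaithfulPositive φ) {x e : A}
    {c : ℂ} (hx : x ≠ 0) (he : IsStarProjection e) (h : star x * x = c • e) : 0 < c := by
  have he0 : e ≠ 0 := by
    rintro rfl
    exact hx (hφ.eq_zero (by simpa using h))
  have h1 := hφ x hx
  have h2 := hφ e he0
  rw [he.isSelfAdjoint.star_eq, he.isIdempotentElem.eq] at h2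
  rw [h, map_smul, smul_eq_mul] at h1
  exact (pos_iff_pos_of_mul_pos h1).mpr h2

/-- A nonzero self-adjoint element has an eigenprojection for some nonzero eigenvalue. It is a
normalisation of `star g * g`, where `g` is the value at `b` of the minimal polynomial with one
linear factor removed. -/
theorem IsFaithfulPositive.exists_eigenprojection [FiniteDimensional ℂ A] {φ : A →ₗ[ℂ] ℂ}
    (hφ : IsFaithfulPositive φ) {b : A} (hb : star b = b) (hb0 : b ≠ 0) :
    ∃ (z : ℂ) (f : A), z ≠ 0 ∧ f ≠ 0 ∧ IsStarProjection f ∧ b * f = z • f := by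
  have hint : IsIntegral ℂ b := IsIntegral.of_finite ℂ b
  have hmonic := minpoly.monic hint
  have hpow : ∀ k : ℕ, b ^ (k + 1) ≠ 0 := by
    intro k
    induction k with
    | zero => simpa using hb0
    | succ k ih =>
      intro h
      apply ih
      rw [pow_succ']
      apply hφ.eq_zero
      rw [star_mul, hb, mul_assoc, ← mul_assoc b b, ← pow_two]
      have : b ^ 2 * b ^ k = 0 := by rw [← pow_add, add_comm]; exact h
      rw [this, mul_zero]
  -- Otherwise the minimal polynomial is a power of `X`, and `b` is nilpotent.
  obtain ⟨z, hz0, hzroot⟩ : ∃ z : ℂ, z ≠ 0 ∧ (minpoly ℂ b).IsRoot z := by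
    by_contra! hcon
    have hall : ∀ z ∈ (minpoly ℂ b).roots, z = 0 := fun z hz => by
      by_contra h0
      exact hcon z h0 (Polynomial.isRoot_of_mem_roots hz)
    have hs := (IsAlgClosed.splits (minpoly ℂ b)).eq_prod_roots
    rw [Multiset.eq_replicate_of_mem hall, hmonic.leadingCoeff] at hs
    have haev := minpoly.aeval ℂ b
    rw [hs] at haev
    simp only [Polynomial.C_0, map_one, sub_zero, Multiset.map_replicate,
      Multiset.prod_replicate, one_mul, map_pow, Polynomial.aeval_X] at haev
    rcases Nat.eq_zero_or_pos (Multiset.card (minpoly ℂ b).roots) with h | h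
    · rw [h, pow_zero] at haev
      exact hb0 (by rw [← one_mul b, haev, zero_mul])
    · obtain ⟨k, hk⟩ := Nat.exists_eq_succ_of_ne_zero h.ne'
      rw [hk] at haev
      exact hpow k haev
  set q := minpoly ℂ b / (Polynomial.X - Polynomial.C z) with hq
  have hfac : (Polynomial.X - Polynomial.C z) * q = minpoly ℂ b :=
    Polynomial.mul_div_eq_iff_isRoot.mpr hzroot
  have hq0 : q ≠ 0 := by
    intro h
    rw [h, mul_zero] at hfac
    exact hmonic.ne_zero hfac.symm
  set g₀ := Polynomial.aeval b q with hg₀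
  have hg₀0 : g₀ ≠ 0 := by
    intro h
    have h1 := minpoly.degree_le_of_ne_zero ℂ b hq0 h
    rw [← hfac, Polynomial.degree_mul, Polynomial.degree_X_sub_C,
      Polynomial.degree_eq_natDegree hq0] at h1
    norm_cast at h1
    omega
  have hbg₀ : b * g₀ = z • g₀ := by
    have h1 := minpoly.aeval ℂ b
    rw [← hfac, map_mul, map_sub, Polynomial.aeval_X, Polynomial.aeval_C, sub_mul,
      ← Algebra.smul_def] at h1
    exact sub_eq_zero.mp h1
  have hcommute : ∀ y : A, Commute b y → ∀ r : Polynomial ℂ, Commute (Polynomial.aeval b r) y := by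
    intro y hy r
    induction r using Polynomial.induction_on' with
    | add p r hp hr => rw [map_add]; exact hp.add_left hr
    | monomial k a =>
      rw [Polynomial.aeval_monomial]
      exact (Algebra.commute_algebraMap_left a y).mul_left (hy.pow_left k)
  have heig : ∀ y : A, b * y = z • y → ∀ r : Polynomial ℂ,
      Polynomial.aeval b r * y = (r.eval z) • y := by
    intro y hy r
    induction r using Polynomial.induction_on' with
    | add p r hp hr => rw [map_add, add_mul, hp, hr, Polynomial.eval_add, add_smul]
    | monomial k a =>
      have hk : ∀ k : ℕ, b ^ k * y = z ^ k • y := by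
        intro k
        induction k with
        | zero => simp
        | succ k ih => rw [pow_succ, mul_assoc, hy, mul_smul_comm, ih, smul_smul, pow_succ']
      rw [Polynomial.aeval_monomial, mul_assoc, hk, Polynomial.eval_monomial,
        ← Algebra.smul_def, smul_smul]
  have hcb : Commute b g₀ := (hcommute b (Commute.refl b) q).symm
  have hcbs : Commute b (star g₀) := by
    have := hcb.star_star
    rwa [hb] at this
  set g := star g₀ * g₀ with hg
  have hg0 : g ≠ 0 := fun h => hg₀0 (hφ.eq_zero h)
  have hgs : star g = g := by simp [hg]
  have hbg : b * g = z • g := by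
    rw [hg, ← mul_assoc, hcbs.eq, mul_assoc, hbg₀, mul_smul_comm]
  have hcbg : Commute b g := hcbs.mul_right hcb
  have h1 : g₀ * g = q.eval z • g := heig g hbg q
  have h2 : g * g₀ = q.eval z • g := by rw [← (hcommute g hcbg q).eq]; exact h1
  have h3 : star g₀ * g = star (q.eval z) • g := by
    have := congrArg star h2
    rwa [star_mul, hgs, star_smul, hgs] at this
  have h4 : g * g = (star (q.eval z) * q.eval z) • g := by
    conv_lhs => rw [hg]
    rw [mul_assoc, ← hg, h1, mul_smul_comm, h3, smul_smul, mul_comm]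
  set c := star (q.eval z) * q.eval z with hc
  have hc0 : c ≠ 0 := by
    intro h
    rw [h, zero_smul] at h4
    exact hg0 (hφ.eq_zero (by rw [hgs]; exact h4))
  have hcs : star c = c := by simp [hc, mul_comm]
  refine ⟨z, c⁻¹ • g, hz0, smul_ne_zero (inv_ne_zero hc0) hg0, ⟨?_, ?_⟩, ?_⟩
  · rw [IsIdempotentElem, smul_mul_smul_comm, h4, smul_smul]
    congr 1
    field_simp
  · rw [IsSelfAdjoint, star_smul, hgs, star_inv₀, hcs]
  · rw [mul_smul_comm, hbg, smul_comm]

/-- A projection `e` whose corner `e * A * e` is larger than the scalars dominates a smaller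
nonzero projection. -/
theorem IsFaithfulPositive.exists_lt_projection [FiniteDimensional ℂ A] {φ : A →ₗ[ℂ] ℂ}
    (hφ : IsFaithfulPositive φ) {e : A} (he : IsStarProjection e) {a : A}
    (ha : ∀ c : ℂ, e * a * e ≠ c • e) :
    ∃ f : A, IsStarProjection f ∧ f ≠ 0 ∧ f ≠ e ∧ e * f = f ∧ f * e = f := by
  have hee : e * e = e := he.isIdempotentElem.eq
  have hes : star e = e := he.isSelfAdjoint.star_eq
  -- The real or the imaginary part of `e * a * e` is not a multiple of `e`.
  obtain ⟨b, hbs, hbe, hbc⟩ : ∃ b : A, star b = b ∧ e * b = b ∧ ∀ c : ℂ, b ≠ c • e := by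
    by_contra! hcon
    set x := e * a * e with hx
    have hex : e * x = x := by rw [hx, ← mul_assoc, ← mul_assoc, hee]
    have hxe : e * star x = star x := by
      have : x * e = x := by rw [hx, mul_assoc, hee]
      have h := congrArg star this
      rwa [star_mul, hes] at h
    obtain ⟨c, hc⟩ := hcon (x + star x) (by simp [add_comm]) (by rw [mul_add, hex, hxe])
    obtain ⟨d, hd⟩ := hcon (Complex.I • (x - star x))
      (by simp [star_smul, smul_sub]; abel) (by rw [mul_smul_comm, mul_sub, hex, hxe])
    apply ha ((1 / 2 : ℂ) * c - (Complex.I / 2) * d)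
    rw [sub_smul, mul_smul, mul_smul, ← hc, ← hd, smul_smul]
    have hI : Complex.I / 2 * Complex.I = -(1 / 2) := by
      rw [div_mul_eq_mul_div, Complex.I_mul_I]; ring
    rw [hI]
    module
  have hb0 : b ≠ 0 := fun h => hbc 0 (by rw [h, zero_smul])
  obtain ⟨z, f, hz, hf0, hf, hbf⟩ := hφ.exists_eigenprojection hbs hb0
  have hef : e * f = f := by
    have h1 : z • (e * f) = z • f := by rw [← mul_smul_comm, ← hbf, ← mul_assoc, hbe]
    exact smul_right_injective A hz h1
  have hfe : f * e = f := by
    have := congrArg star hef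
    rwa [star_mul, hes, hf.isSelfAdjoint.star_eq] at this
  refine ⟨f, hf, hf0, ?_, hef, hfe⟩
  rintro rfl
  have hbe' : b * f = b := by
    have := congrArg star hbe
    rwa [star_mul, hbs, hes] at this
  exact hbc z (by rw [← hbf, hbe'])

/-- A decomposition of the unit into pairwise orthogonal minimal projections; minimality is
expressed by the corners `e i * A * e i` being one-dimensional. -/
structure IsMinimalDecomposition {ι : Type*} [Fintype ι] (e : ι → A) : Prop where
  isStarProjection : ∀ i, IsStarProjection (e i)
  ne_zero : ∀ i, e i ≠ 0
  mul_eq_zero : ∀ i j, i ≠ j → e i * e j = 0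
  sum_eq_one : ∑ i, e i = 1
  minimal : ∀ i a, ∃ c : ℂ, e i * a * e i = c • e i

/-- Every projection is a finite sum of orthogonal minimal projections, by induction on the
dimension of its corner. -/
theorem IsFaithfulPositive.exists_minimal_finset [FiniteDimensional ℂ A] {φ : A →ₗ[ℂ] ℂ}
    (hφ : IsFaithfulPositive φ) (k : ℕ) : ∀ e : A, IsStarProjection e →
      Module.finrank ℂ (LinearMap.range (LinearMap.mulLeftRight ℂ (e, e))) ≤ k →
      ∃ s : Finset A, (∀ x ∈ s, IsStarProjection x ∧ x ≠ 0 ∧ e * x = x ∧ x * e = x ∧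
          ∀ a, ∃ c : ℂ, x * a * x = c • x) ∧
        (∀ x ∈ s, ∀ y ∈ s, x ≠ y → x * y = 0) ∧ ∑ x ∈ s, x = e := by
  classical
  induction k with
  | zero =>
    intro e he hk
    refine ⟨∅, by simp, by simp, ?_⟩
    have hbot := Submodule.finrank_eq_zero.mp (Nat.le_zero.mp hk)
    have : e ∈ LinearMap.range (LinearMap.mulLeftRight ℂ (e, e)) :=
      ⟨e, by simp [he.isIdempotentElem.eq]⟩
    rw [hbot, Submodule.mem_bot] at this
    simp [this]
  | succ k ih =>
    intro e he hk
    have hee : e * e = e := he.isIdempotentElem.eq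
    by_cases he0 : e = 0
    · exact ⟨∅, by simp, by simp, by simp [he0]⟩
    by_cases hmin : ∀ a, ∃ c : ℂ, e * a * e = c • e
    · refine ⟨{e}, ?_, ?_, by simp⟩
      · simpa using ⟨he, he0, hee, hmin⟩
      · intro x hx y hy hxy
        simp only [Finset.mem_singleton] at hx hy
        exact absurd (hx.trans hy.symm) hxy
    push Not at hmin
    obtain ⟨a, ha⟩ := hmin
    obtain ⟨f, hf, hf0, hfne, hef, hfe⟩ := hφ.exists_lt_projection he ha
    have hff : f * f = f := hf.isIdempotentElem.eq
    set g := e - f with hg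
    have hgg : IsStarProjection g := by
      refine ⟨?_, he.isSelfAdjoint.sub hf.isSelfAdjoint⟩
      simp only [IsIdempotentElem, hg, mul_sub, sub_mul, hee, hef, hfe, hff]; abel
    have hg0 : g ≠ 0 := sub_ne_zero.mpr hfne.symm
    have heg : e * g = g := by rw [hg, mul_sub, hee, hef]
    have hge : g * e = g := by rw [hg, sub_mul, hee, hfe]
    have hfg : f * g = 0 := by rw [hg, mul_sub, hfe, hff, sub_self]
    have hgf : g * f = 0 := by rw [hg, sub_mul, hef, hff, sub_self]
    have hlt : ∀ x y : A, IsStarProjection x → y ≠ 0 → e * y = y → y * e = y → e * x = x →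
        x * e = x → x * y = 0 →
        Module.finrank ℂ (LinearMap.range (LinearMap.mulLeftRight ℂ (x, x))) ≤ k := by
      intro x y hx hy0 hey hye hex hxe hxy
      apply Nat.le_of_lt_succ
      refine lt_of_lt_of_le (Submodule.finrank_lt_finrank_of_lt ?_) hk
      refine SetLike.lt_iff_le_and_exists.mpr
        ⟨?_, y, LinearMap.mem_range.mpr ⟨y, by simp [hey, hye]⟩, ?_⟩
      · rintro _ ⟨w, rfl⟩
        refine ⟨x * w * x, ?_⟩
        simp only [LinearMap.mulLeftRight_apply]
        rw [← mul_assoc, ← mul_assoc, hex, mul_assoc, hxe]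
      · rintro ⟨w, hw⟩
        simp only [LinearMap.mulLeftRight_apply] at hw
        apply hy0
        have h1 : x * y = y := by
          rw [← hw, ← mul_assoc, ← mul_assoc, hx.isIdempotentElem.eq]
        rw [← h1, hxy]
    obtain ⟨s, hs, hsorth, hssum⟩ := ih f hf (hlt f g hf hg0 heg hge hef hfe hfg)
    obtain ⟨t, ht, htorth, htsum⟩ := ih g hgg (hlt g f hgg hf0 hef hfe heg hge hgf)
    have hst : ∀ x ∈ s, ∀ y ∈ t, x * y = 0 := fun x hx y hy => by
      rw [← (hs x hx).2.2.2.1, ← (ht y hy).2.2.1, mul_assoc, ← mul_assoc f, hfg, zero_mul,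
        mul_zero]
    have hts : ∀ x ∈ t, ∀ y ∈ s, x * y = 0 := fun x hx y hy => by
      rw [← (ht x hx).2.2.2.1, ← (hs y hy).2.2.1, mul_assoc, ← mul_assoc g, hgf, zero_mul,
        mul_zero]
    have hdisj : Disjoint s t := by
      rw [Finset.disjoint_left]
      intro x hx hx'
      apply (hs x hx).2.1
      rw [← (hs x hx).1.isIdempotentElem.eq]
      exact hst x hx x hx'
    refine ⟨s ∪ t, ?_, ?_, ?_⟩
    · intro x hx
      rcases Finset.mem_union.mp hx with hx | hx
      · obtain ⟨h1, h2, h3, h4, h5⟩ := hs x hx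
        refine ⟨h1, h2, ?_, ?_, h5⟩
        · rw [← h3, ← mul_assoc, hef]
        · rw [← h4, mul_assoc, hfe]
      · obtain ⟨h1, h2, h3, h4, h5⟩ := ht x hx
        refine ⟨h1, h2, ?_, ?_, h5⟩
        · rw [← h3, ← mul_assoc, heg]
        · rw [← h4, mul_assoc, hge]
    · intro x hx y hy hxy
      rcases Finset.mem_union.mp hx with hx | hx <;> rcases Finset.mem_union.mp hy with hy | hy
      · exact hsorth x hx y hy hxy
      · exact hst x hx y hy
      · exact hts x hx y hy
      · exact htorth x hx y hy hxy
    · rw [Finset.sum_union hdisj, hssum, htsum, hg]; abel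

theorem IsFaithfulPositive.exists_minimalDecomposition [FiniteDimensional ℂ A] {φ : A →ₗ[ℂ] ℂ}
    (hφ : IsFaithfulPositive φ) : ∃ (N : ℕ) (e : Fin N → A), IsMinimalDecomposition e := by
  obtain ⟨s, hs, horth, hsum⟩ := hφ.exists_minimal_finset _ 1 (IsStarProjection.one A) le_rfl
  let f : Fin s.card ≃ s := s.equivFin.symm
  refine ⟨s.card, fun i => f i, ?_, ?_, ?_, ?_, ?_⟩
  · exact fun i => (hs _ (f i).2).1
  · exact fun i => (hs _ (f i).2).2.1
  · intro i j hij
    refine horth _ (f i).2 _ (f j).2 fun h => hij (f.injective (Subtype.ext h))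
  · rw [f.sum_comp (fun x : s => (x : A)), ← hsum, Finset.sum_coe_sort s (fun x => x)]
  · exact fun i => (hs _ (f i).2).2.2.2.2

end StarAlgebra

/-! ### Equivalent minimal projections and dimension bounds -/

section StarAlgebra

variable {A : Type*} [Ring A] [Algebra ℂ A] [StarRing A] [StarModule ℂ A]

/-- Minimal projections `e`, `f` are linked when `e * A * f ≠ 0`, i.e. when they lie in the same
simple summand of `A`. -/
def Linked (e f : A) : Prop := ∃ a : A, e * a * f ≠ 0

namespace IsMinimalDecomposition

variable {ι : Type*} [Fintype ι] {e : ι → A}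

theorem mul_self (he : IsMinimalDecomposition e) (i : ι) : e i * e i = e i :=
  (he.isStarProjection i).isIdempotentElem.eq

theorem star_eq (he : IsMinimalDecomposition e) (i : ι) : star (e i) = e i :=
  (he.isStarProjection i).isSelfAdjoint.star_eq

theorem linked_refl (he : IsMinimalDecomposition e) (i : ι) : Linked (e i) (e i) :=
  ⟨1, by rw [mul_one, he.mul_self]; exact he.ne_zero i⟩

theorem linked_symm (he : IsMinimalDecomposition e) {i j : ι} (h : Linked (e i) (e j)) :
    Linked (e j) (e i) := by
  obtain ⟨a, ha⟩ := h
  refine ⟨star a, fun h0 => ha ?_⟩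
  have := congrArg star h0
  simpa [he.star_eq, mul_assoc] using this

variable {φ : A →ₗ[ℂ] ℂ}

/-- Linked minimal projections are the final and initial projections of a partial isometry. -/
theorem exists_partialIsometry (he : IsMinimalDecomposition e) (hφ : IsFaithfulPositive φ)
    {i j : ι} (h : Linked (e i) (e j)) :
    ∃ u : A, e i * u = u ∧ u * e j = u ∧ u * star u = e i ∧ star u * u = e j := by
  obtain ⟨a, ha⟩ := h
  set x := e i * a * e j with hx
  have hex : e i * x = x := by rw [hx, ← mul_assoc, ← mul_assoc, he.mul_self]
  have hxe : x * e j = x := by rw [hx, mul_assoc, he.mul_self]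
  have hsex : e j * star x = star x := by
    have := congrArg star hxe
    rwa [star_mul, he.star_eq] at this
  have hsxe : star x * e i = star x := by
    have := congrArg star hex
    rwa [star_mul, he.star_eq] at this
  obtain ⟨c, hc⟩ := he.minimal j (star x * x)
  obtain ⟨d, hd⟩ := he.minimal i (x * star x)
  rw [← mul_assoc, hsex, mul_assoc, hxe] at hc
  rw [← mul_assoc, hex, mul_assoc, hsxe] at hd
  have hcpos := hφ.pos_of_smul ha (he.isStarProjection j) hc
  have hcd : d = c := by
    have h1 : x * star x * x = c • x := by rw [mul_assoc, hc, mul_smul_comm, hxe]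
    rw [hd, smul_mul_assoc, hex] at h1
    exact smul_left_injective ℂ ha h1
  obtain ⟨r, hr, rfl⟩ : ∃ r : ℝ, 0 < r ∧ (r : ℂ) = c := by
    refine ⟨c.re, (Complex.pos_iff.mp hcpos).1, ?_⟩
    apply Complex.ext <;> simp [(Complex.pos_iff.mp hcpos).2]
  set s : ℂ := (((Real.sqrt r)⁻¹ : ℝ) : ℂ) with hs
  have hss : star s = s := by simp [hs]
  have hsr : s * s * r = 1 := by
    rw [hs]
    norm_cast
    rw [← mul_inv, Real.mul_self_sqrt hr.le, inv_mul_cancel₀ hr.ne']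
  refine ⟨s • x, by rw [mul_smul_comm, hex], by rw [smul_mul_assoc, hxe], ?_, ?_⟩
  · rw [star_smul, smul_mul_smul_comm, hd, hcd, smul_smul, hss, hsr, one_smul]
  · rw [star_smul, smul_mul_smul_comm, hc, smul_smul, hss, hsr, one_smul]

theorem linked_trans (he : IsMinimalDecomposition e) (hφ : IsFaithfulPositive φ)
    {i j k : ι} (h : Linked (e i) (e j)) (h' : Linked (e j) (e k)) : Linked (e i) (e k) := by
  obtain ⟨u, hu1, hu2, hu3, hu4⟩ := he.exists_partialIsometry hφ h
  obtain ⟨v, hv1, hv2, hv3, hv4⟩ := he.exists_partialIsometry hφ h'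
  refine ⟨u * v, fun h0 => he.ne_zero k ?_⟩
  rw [← mul_assoc, hu1, mul_assoc, hv2] at h0
  have h1 : star u * (u * v) = v := by rw [← mul_assoc, hu4, hv1]
  rw [h0, mul_zero] at h1
  rw [← hv4, ← h1, mul_zero]

/-- The spaces `e i * A * e j` are at most one-dimensional. -/
theorem exists_smul_eq (he : IsMinimalDecomposition e) {i j : ι} {u : A}
    (hu1 : e i * u = u) (hu4 : star u * u = e j)
    (a : A) : ∃ c : ℂ, e i * a * e j = c • u := by
  obtain ⟨c, hc⟩ := he.minimal i (a * star u)
  refine ⟨c, ?_⟩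
  have hsu : star u * e i = star u := by
    have := congrArg star hu1
    rwa [star_mul, he.star_eq] at this
  calc e i * a * e j = e i * (a * star u) * u := by
        rw [← hu4]; simp only [mul_assoc]
    _ = e i * (a * star u) * e i * u := by rw [mul_assoc _ (e i), hu1]
    _ = c • u := by rw [hc, smul_mul_assoc, hu1]

theorem sum_mul (he : IsMinimalDecomposition e) (a : A) : ∑ i, e i * a = a := by
  rw [← Finset.sum_mul, he.sum_eq_one, one_mul]

theorem mul_sum (he : IsMinimalDecomposition e) (a : A) : ∑ i, a * e i = a := by
  rw [← Finset.mul_sum, he.sum_eq_one, mul_one]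

/-- A family of elements `F j` separated by left ideals `J j`, in the sense that
`F j ∈ J k ↔ j ≠ k`, has at most as many members as the decomposition.
Choosing a representative of each class of linked projections, and partial isometries `u i` from
`e i` to the representative, some `u i * F j` lies outside `J j`; these elements are linearly
independent and lie in the span of the `u i`. -/
theorem card_le_of_separated (he : IsMinimalDecomposition e) (hφ : IsFaithfulPositive φ)
    {D : ℕ} (J : Fin D → Submodule A A) (F : Fin D → A)
    (hF : ∀ j, F j ∉ J j) (hF' : ∀ j k, j ≠ k → F j ∈ J k) : D ≤ Fintype.card ι := by
  let s : Setoid ι :=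
    { r := fun i j => Linked (e i) (e j)
      iseqv := ⟨he.linked_refl, he.linked_symm, he.linked_trans hφ⟩ }
  let r : ι → ι := fun i => (Quotient.mk s i).out
  have hr : ∀ i, Linked (e (r i)) (e i) := fun i => Quotient.exact (s := s) (Quotient.out_eq _)
  have hr' : ∀ i j, Linked (e i) (e j) → r i = r j := fun i j h => by
    simp only [r]
    rw [Quotient.sound (s := s) h]
  choose u hu1 hu2 hu3 hu4 using fun i => he.exists_partialIsometry hφ (hr i)
  have hmem : ∀ i a, u i * a ∈ Submodule.span ℂ (Set.range u) := by
    intro i a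
    rw [← he.mul_sum (u i * a)]
    refine Submodule.sum_mem _ fun k _ => ?_
    by_cases h : u i * a * e k = 0
    · rw [h]; exact Submodule.zero_mem _
    · have hl : Linked (e (r i)) (e k) := by
        refine ⟨u i * a, ?_⟩
        rwa [← mul_assoc (e (r i)), hu1]
      have hik : r i = r k := hr' _ _ (he.linked_trans hφ (he.linked_symm (hr i)) hl)
      obtain ⟨c, hc⟩ := he.exists_smul_eq (hu1 k) (hu4 k) (u i * a)
      rw [← mul_assoc (e (r k)), ← hik, hu1] at hc
      rw [hc]
      exact Submodule.smul_mem _ _ (Submodule.subset_span ⟨k, rfl⟩)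
  have hex : ∀ j, ∃ i, u i * F j ∉ J j := by
    intro j
    by_contra! hcon
    apply hF j
    rw [← he.sum_mul (F j)]
    refine Submodule.sum_mem _ fun i _ => ?_
    rw [← hu4 i, mul_assoc]
    exact (J j).smul_mem (star (u i)) (hcon i)
  choose i hi using hex
  have hli : LinearIndependent ℂ (fun j => u (i j) * F j) := by
    rw [Fintype.linearIndependent_iff]
    intro c hc k
    by_contra hk
    apply hi k
    have h1 : c k • (u (i k) * F k) ∈ J k := by
      have h2 : c k • (u (i k) * F k) =
          - ∑ j ∈ Finset.univ.erase k, c j • (u (i j) * F j) := by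
        rw [eq_neg_iff_add_eq_zero,
          Finset.add_sum_erase _ (fun j => c j • (u (i j) * F j)) (Finset.mem_univ k), hc]
      rw [h2]
      refine (J k).neg_mem (Submodule.sum_mem _ fun j hj => ?_)
      rw [← smul_mul_assoc]
      exact (J k).smul_mem (c j • u (i j)) (hF' j k (Finset.ne_of_mem_erase hj))
    have h3 : u (i k) * F k = algebraMap ℂ A (c k)⁻¹ • (c k • (u (i k) * F k)) := by
      rw [smul_eq_mul, ← Algebra.smul_def, smul_smul, inv_mul_cancel₀ hk, one_smul]
    rw [h3]
    exact (J k).smul_mem _ h1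
  have hfin : Module.Finite ℂ (Submodule.span ℂ (Set.range u)) :=
    FiniteDimensional.span_of_finite ℂ (Set.finite_range u)
  have h1 := finrank_range_le_card (R := ℂ) u
  have h2 : LinearIndependent ℂ
      (fun j => (⟨u (i j) * F j, hmem _ _⟩ : Submodule.span ℂ (Set.range u))) :=
    LinearIndependent.of_comp (Submodule.subtype _) hli
  have h3 := h2.fintype_card_le_finrank
  rw [Fintype.card_fin] at h3
  exact h3.trans h1

/-- A nonzero linear map from `A` to `ℂ^D` which intertwines left multiplications with all the
matrices bounds `D` by the number of minimal projections linked to a single one: it is surjective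
on some left ideal `A * e i`. -/
theorem exists_le_card_linked [DecidableEq ι] (he : IsMinimalDecomposition e)
    (hφ : IsFaithfulPositive φ)
    [∀ i j, Decidable (Linked (e i) (e j))]
    {D : ℕ} (g : A →ₗ[ℂ] (Fin D → ℂ)) (hg : g ≠ 0)
    (h : ∀ x : Matrix (Fin D) (Fin D) ℂ, ∃ b : A, ∀ a, g (b * a) = x.mulVec (g a)) :
    ∃ i, D ≤ (Finset.univ.filter fun k => Linked (e k) (e i)).card := by
  obtain ⟨a, ha⟩ : ∃ a, g a ≠ 0 := by
    by_contra! hcon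
    exact hg (LinearMap.ext hcon)
  obtain ⟨i, hi⟩ : ∃ i, g (a * e i) ≠ 0 := by
    by_contra! hcon
    apply ha
    rw [← he.mul_sum a, map_sum]
    exact Finset.sum_eq_zero fun i _ => hcon i
  refine ⟨i, ?_⟩
  have hu : ∀ k, ∃ u : A, Linked (e k) (e i) →
      e k * u = u ∧ u * e i = u ∧ u * star u = e k ∧ star u * u = e i := by
    intro k
    by_cases hk : Linked (e k) (e i)
    · obtain ⟨u, hu⟩ := he.exists_partialIsometry hφ hk
      exact ⟨u, fun _ => hu⟩
    · exact ⟨0, fun h => absurd h hk⟩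
  choose u hu using hu
  set s : Finset ι := Finset.univ.filter fun k => Linked (e k) (e i) with hs
  have hspan : ⊤ ≤ Submodule.span ℂ ((s.image fun k => g (u k) : Finset (Fin D → ℂ)) :
      Set (Fin D → ℂ)) := by
    intro w _
    set v := g (a * e i) with hv
    obtain ⟨l, hl⟩ := Function.ne_iff.mp hi
    simp only [Pi.zero_apply] at hl
    obtain ⟨b, hb⟩ := h (Matrix.of fun p q => if q = l then w p * (v l)⁻¹ else 0)
    have hw : w = g (b * (a * e i)) := by
      rw [hb]
      ext p
      simp only [Matrix.mulVec, dotProduct, Matrix.of_apply, ite_mul, zero_mul,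
        Finset.sum_ite_eq', Finset.mem_univ, if_true]
      rw [mul_assoc, inv_mul_cancel₀ hl, mul_one]
    rw [hw, ← mul_assoc, ← he.sum_mul (b * a * e i), map_sum]
    refine Submodule.sum_mem _ fun k _ => ?_
    by_cases hk : Linked (e k) (e i)
    · obtain ⟨h1, -, -, h4⟩ := hu k hk
      obtain ⟨c, hc⟩ := he.exists_smul_eq h1 h4 (b * a)
      rw [← mul_assoc, hc, map_smul]
      refine Submodule.smul_mem _ _ (Submodule.subset_span ?_)
      simp only [Finset.coe_image, Set.mem_image]
      exact ⟨k, by simp [hs, hk], rfl⟩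
    · have : e k * (b * a * e i) = 0 := by
        by_contra h0
        exact hk ⟨b * a, by rwa [mul_assoc]⟩
      rw [this, map_zero]
      exact Submodule.zero_mem _
  have h1 := finrank_span_finset_le_card (R := ℂ) (s.image fun k => g (u k))
  rw [Set.finrank, top_le_iff.mp hspan, finrank_top, Module.finrank_fin_fun] at h1
  exact h1.trans Finset.card_image_le

end IsMinimalDecomposition

/-! ### Tensor products of decompositions -/

section Tensor

variable {B C : Type*} [Ring B] [Algebra ℂ B] [StarRing B] [StarModule ℂ B]
  [Ring C] [Algebra ℂ C] [StarRing C] [StarModule ℂ C]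

/-- A bilinear map which exhibits the *-algebra `C` as spanned by multiplicative elementary
tensors of elements of `A` and `B`. -/
structure IsAlgebraTensor (t : A →ₗ[ℂ] B →ₗ[ℂ] C) : Prop where
  map_mul : ∀ a a' b b', t (a * a') (b * b') = t a b * t a' b'
  map_star : ∀ a b, t (star a) (star b) = star (t a b)
  map_one : t 1 1 = 1
  ne_zero : ∀ a b, a ≠ 0 → b ≠ 0 → t a b ≠ 0
  span_eq_top : Submodule.span ℂ (Set.range fun x : A × B => t x.1 x.2) = ⊤

variable {t : A →ₗ[ℂ] B →ₗ[ℂ] C} {ι ι' : Type*} [Fintype ι] [Fintype ι'] {e : ι → A} {f : ι' → B}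

theorem IsAlgebraTensor.induction (ht : IsAlgebraTensor t) {p : C → Prop} (h0 : p 0)
    (hadd : ∀ x y, p x → p y → p (x + y)) (ht' : ∀ a b, p (t a b)) (c : C) : p c := by
  have hc : c ∈ Submodule.span ℂ (Set.range fun x : A × B => t x.1 x.2) := by
    rw [ht.span_eq_top]; trivial
  have h : ∀ z : ℂ, p (z • c) := by
    induction hc using Submodule.span_induction with
    | mem x hx =>
      obtain ⟨⟨a, b⟩, rfl⟩ := hx
      intro z
      simpa using ht' (z • a) b
    | zero => simpa using h0
    | add x y _ _ hx hy => intro z; rw [smul_add]; exact hadd _ _ (hx z) (hy z)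
    | smul w x _ hx => intro z; rw [smul_smul]; exact hx _
  simpa using h 1

theorem IsAlgebraTensor.isMinimalDecomposition (ht : IsAlgebraTensor t)
    (he : IsMinimalDecomposition e) (hf : IsMinimalDecomposition f) :
    IsMinimalDecomposition (fun i : ι × ι' => t (e i.1) (f i.2)) where
  isStarProjection i := by
    refine ⟨?_, ?_⟩
    · rw [IsIdempotentElem, ← ht.map_mul, he.mul_self, hf.mul_self]
    · rw [IsSelfAdjoint, ← ht.map_star, he.star_eq, hf.star_eq]
  ne_zero i := ht.ne_zero _ _ (he.ne_zero _) (hf.ne_zero _)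
  mul_eq_zero i j hij := by
    rw [← ht.map_mul]
    by_cases h : i.1 = j.1
    · rw [hf.mul_eq_zero _ _ fun h' => hij (Prod.ext h h'), _root_.map_zero]
    · rw [he.mul_eq_zero _ _ h, _root_.map_zero, LinearMap.zero_apply]
  sum_eq_one := by
    rw [Fintype.sum_prod_type]
    simp only [← map_sum, ← LinearMap.sum_apply, he.sum_eq_one, hf.sum_eq_one, ht.map_one]
  minimal i c := by
    induction c using ht.induction with
    | h0 => exact ⟨0, by simp⟩
    | hadd x y hx hy =>
      obtain ⟨c, hc⟩ := hx
      obtain ⟨d, hd⟩ := hy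
      exact ⟨c + d, by rw [mul_add, add_mul, hc, hd, add_smul]⟩
    | ht' a b =>
      obtain ⟨c, hc⟩ := he.minimal i.1 a
      obtain ⟨d, hd⟩ := hf.minimal i.2 b
      refine ⟨c * d, ?_⟩
      rw [← ht.map_mul, ← ht.map_mul, hc, hd]
      simp [smul_smul, mul_comm]

theorem IsAlgebraTensor.linked_iff (ht : IsAlgebraTensor t) {a a' : A} {b b' : B} :
    Linked (t a b) (t a' b') ↔ Linked a a' ∧ Linked b b' := by
  constructor
  · rintro ⟨c, hc⟩
    by_contra hcon
    apply hc
    clear hc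
    induction c using ht.induction with
    | h0 => simp
    | hadd x y hx hy => rw [mul_add, add_mul, hx, hy, add_zero]
    | ht' x y =>
      rw [← ht.map_mul, ← ht.map_mul]
      by_cases h : a * x * a' = 0
      · rw [h, _root_.map_zero, LinearMap.zero_apply]
      · have : b * y * b' = 0 := by
          by_contra h'
          exact hcon ⟨⟨x, h⟩, ⟨y, h'⟩⟩
        rw [this, _root_.map_zero]
  · rintro ⟨⟨x, hx⟩, ⟨y, hy⟩⟩
    refine ⟨t x y, ?_⟩
    rw [← ht.map_mul, ← ht.map_mul]
    exact ht.ne_zero _ _ hx hy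

end Tensor

end StarAlgebra

/-! ### The Choi–Effros algebra of an idempotent channel -/

section ChoiEffros

variable {n m κ μ : Type*} [Fintype n] [DecidableEq n] [Fintype m] [DecidableEq m]
  [Fintype κ] [Fintype μ]

theorem eq_zero_of_trace_sum_conjTranspose_mul_self {ν p q : Type*} [Fintype ν] [Fintype p]
    [Fintype q] {Z : ν → Matrix p q ℂ} (h : (∑ i, (Z i).conjTranspose * Z i).trace = 0) (i : ν) :
    Z i = 0 := by
  rw [Matrix.trace_sum, Finset.sum_eq_zero_iff_of_nonneg
    fun i _ => (Matrix.posSemidef_conjTranspose_mul_self (Z i)).trace_nonneg] at h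
  exact Matrix.trace_conjTranspose_mul_self_eq_zero_iff.mp (h i (Finset.mem_univ i))

/-- Kraus operators of an idempotent channel. -/
structure IsRetraction (K : κ → Matrix n n ℂ) : Prop where
  sum_eq_one : ∑ i, (K i).conjTranspose * K i = 1
  idem : ∀ X, kraus K (kraus K X) = kraus K X

theorem krausDual_one {K : κ → Matrix m n ℂ} (hK : ∑ i, (K i).conjTranspose * K i = 1) :
    krausDual K 1 = 1 := by
  simpa [krausDual_apply] using hK

theorem krausDual_conjTranspose (K : κ → Matrix m n ℂ) (X : Matrix m m ℂ) :
    krausDual K X.conjTranspose = (krausDual K X).conjTranspose :=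
  kraus_conjTranspose _ X

theorem krausDual_posSemidef (K : κ → Matrix m n ℂ) {X : Matrix m m ℂ} (hX : X.PosSemidef) :
    (krausDual K X).PosSemidef :=
  kraus_posSemidef _ hX

/-- The defect in the Kadison–Schwarz inequality for a unital map, as a sum of squares. -/
theorem sum_schwarz_defect {K : κ → Matrix m n ℂ} (hK : ∑ i, (K i).conjTranspose * K i = 1)
    (a : Matrix m m ℂ) (b : Matrix n n ℂ) (hab : krausDual K a = b) :
    ∑ i, (a * K i - K i * b).conjTranspose * (a * K i - K i * b)
      = krausDual K (a.conjTranspose * a) - b.conjTranspose * b := by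
  have h1 : ∑ i, (K i).conjTranspose * a.conjTranspose * K i = b.conjTranspose := by
    rw [← krausDual_apply, krausDual_conjTranspose, hab]
  have h2 : ∑ i, (K i).conjTranspose * a * K i = b := by rw [← krausDual_apply, hab]
  have h3 : ∀ i, (a * K i - K i * b).conjTranspose * (a * K i - K i * b)
      = (K i).conjTranspose * (a.conjTranspose * a) * K i
        - (K i).conjTranspose * a.conjTranspose * K i * b
        - b.conjTranspose * ((K i).conjTranspose * a * K i)
        + b.conjTranspose * ((K i).conjTranspose * K i) * b := by
    intro i
    simp only [Matrix.conjTranspose_sub, Matrix.conjTranspose_mul]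
    simp only [Matrix.sub_mul, Matrix.mul_sub, Matrix.mul_assoc]
    abel
  simp only [h3, Finset.sum_add_distrib, Finset.sum_sub_distrib]
  rw [← krausDual_apply, ← Finset.sum_mul, h1, ← Finset.mul_sum, h2, ← Finset.sum_mul,
    ← Finset.mul_sum, hK, mul_one]
  abel

namespace IsRetraction

variable {K : κ → Matrix n n ℂ} (hK : IsRetraction K)
include hK

theorem krausDual_idem (X : Matrix n n ℂ) : krausDual K (krausDual K X) = krausDual K X := by
  refine trace_mul_right_injective fun Y => ?_
  rw [← trace_mul_kraus, ← trace_mul_kraus, hK.idem, trace_mul_kraus]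

/-- A fixed point of the adjoint of an idempotent channel commutes with the Kraus operators to the
left of another Kraus operator: its Schwarz defect vanishes after one more application of the
adjoint. -/
theorem mul_mul_eq {a : Matrix n n ℂ} (ha : krausDual K a = a) (i j : κ) :
    a * K i * K j = K i * a * K j := by
  have h1 : krausDual K (∑ i, (a * K i - K i * a).conjTranspose * (a * K i - K i * a)) = 0 := by
    rw [sum_schwarz_defect hK.sum_eq_one a a ha, map_sub, hK.krausDual_idem, sub_eq_zero]
  have h2 : ∑ x : κ × κ, ((a * K x.1 - K x.1 * a) * K x.2).conjTranspose
      * ((a * K x.1 - K x.1 * a) * K x.2) = 0 := by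
    rw [← h1, krausDual_apply, Fintype.sum_prod_type_right]
    simp only [Matrix.mul_sum, Matrix.sum_mul, Matrix.conjTranspose_mul, Matrix.mul_assoc]
  have h3 := eq_zero_of_trace_sum_conjTranspose_mul_self (by rw [h2, Matrix.trace_zero]) (i, j)
  rwa [Matrix.sub_mul, sub_eq_zero] at h3

/-- On the threefold products of Kraus operators, the product `krausDual K (a * b)` of two fixed
points acts like the matrix product `a * b`, also after a further fixed point `c`. -/
theorem krausDual_mul_mul {a b c : Matrix n n ℂ} (ha : krausDual K a = a) (hb : krausDual K b = b)
    (hc : krausDual K c = c) (i j k : κ) :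
    krausDual K (a * b) * c * (K i * K j * K k) = a * b * c * (K i * K j * K k) := by
  have h1 : ∀ j k, krausDual K (a * b) * (K j * K k) = a * b * (K j * K k) := by
    intro j k
    have h2 : ∀ l, (K l).conjTranspose * (a * b) * K l * (K j * K k)
        = (K l).conjTranspose * K l * (a * b * (K j * K k)) := by
      intro l
      calc (K l).conjTranspose * (a * b) * K l * (K j * K k)
          = (K l).conjTranspose * a * (b * K l * K j) * K k := by simp only [Matrix.mul_assoc]
        _ = (K l).conjTranspose * (a * K l) * (b * K j * K k) := by
          rw [hK.mul_mul_eq hb]; simp only [Matrix.mul_assoc]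
        _ = (K l).conjTranspose * (a * K l * K j) * b * K k := by
          rw [hK.mul_mul_eq hb]; simp only [Matrix.mul_assoc]
        _ = (K l).conjTranspose * K l * a * (K j * b * K k) := by
          rw [hK.mul_mul_eq ha]; simp only [Matrix.mul_assoc]
        _ = _ := by
          rw [← hK.mul_mul_eq hb]; simp only [Matrix.mul_assoc]
    rw [krausDual_apply, Matrix.sum_mul, Finset.sum_congr rfl fun l _ => h2 l, ← Matrix.sum_mul,
      hK.sum_eq_one, one_mul]
  calc krausDual K (a * b) * c * (K i * K j * K k)
      = krausDual K (a * b) * (c * K i * K j) * K k := by simp only [Matrix.mul_assoc]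
    _ = krausDual K (a * b) * K i * (c * K j * K k) := by
      rw [hK.mul_mul_eq hc]; simp only [Matrix.mul_assoc]
    _ = krausDual K (a * b) * (K i * K j) * (c * K k) := by
      rw [hK.mul_mul_eq hc]; simp only [Matrix.mul_assoc]
    _ = a * b * K i * (K j * c * K k) := by
      rw [h1]; simp only [Matrix.mul_assoc]
    _ = a * b * (K i * c * K j) * K k := by
      rw [← hK.mul_mul_eq hc]; simp only [Matrix.mul_assoc]
    _ = _ := by
      rw [← hK.mul_mul_eq hc]; simp only [Matrix.mul_assoc]

theorem krausDual_mul_kraus {a b : Matrix n n ℂ} (ha : krausDual K a = a)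
    (hb : krausDual K b = b) (X : Matrix n n ℂ) :
    krausDual K (a * b) * kraus K X = a * b * kraus K X := by
  rw [← hK.idem X, ← hK.idem (kraus K X)]
  simp only [kraus_apply, Matrix.mul_sum, Matrix.sum_mul]
  refine Finset.sum_congr rfl fun i _ => Finset.sum_congr rfl fun j _ =>
    Finset.sum_congr rfl fun k _ => ?_
  have h := congrArg (fun Z => Z * (X * (K k).conjTranspose * (K j).conjTranspose
    * (K i).conjTranspose)) (hK.krausDual_mul_mul ha hb (krausDual_one hK.sum_eq_one) i j k)
  simpa only [mul_one, Matrix.mul_assoc] using h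

/-- A threefold application of the adjoint, written out. -/
theorem krausDual_eq_sum (X : Matrix n n ℂ) :
    krausDual K X = ∑ i, ∑ j, ∑ k, (K i * K j * K k).conjTranspose * (X * (K i * K j * K k)) := by
  conv_lhs => rw [← hK.krausDual_idem X, ← hK.krausDual_idem (krausDual K X)]
  simp only [krausDual_apply, Matrix.mul_sum, Matrix.sum_mul, Matrix.conjTranspose_mul,
    Matrix.mul_assoc]
  rw [Finset.sum_comm, Finset.sum_congr rfl fun _ _ => Finset.sum_comm, Finset.sum_comm]

theorem krausDual_assoc_left {a b c : Matrix n n ℂ} (ha : krausDual K a = a)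
    (hb : krausDual K b = b) (hc : krausDual K c = c) :
    krausDual K (krausDual K (a * b) * c) = krausDual K (a * b * c) := by
  simp only [hK.krausDual_eq_sum (krausDual K (a * b) * c), hK.krausDual_eq_sum (a * b * c),
    hK.krausDual_mul_mul ha hb hc]

theorem krausDual_assoc_right {a b c : Matrix n n ℂ} (ha : krausDual K a = a)
    (hb : krausDual K b = b) (hc : krausDual K c = c) :
    krausDual K (a * krausDual K (b * c)) = krausDual K (a * (b * c)) := by
  have h1 : ∀ x : Matrix n n ℂ, krausDual K x = x →
      krausDual K x.conjTranspose = x.conjTranspose :=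
    fun x hx => by rw [krausDual_conjTranspose, hx]
  have h := congrArg Matrix.conjTranspose (hK.krausDual_assoc_left (h1 c hc) (h1 b hb) (h1 a ha))
  simpa only [← krausDual_conjTranspose, Matrix.conjTranspose_mul,
    Matrix.conjTranspose_conjTranspose] using h

end IsRetraction

/-- The fixed points of the adjoint of an idempotent channel. They form a *-algebra for the
Choi–Effros product `a ∘ b = krausDual K (a * b)`, which differs from the matrix product in
general. -/
def FixedAlgebra {K : κ → Matrix n n ℂ} (_ : IsRetraction K) : Type _ :=
  LinearMap.eqLocus (krausDual K) LinearMap.id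

namespace FixedAlgebra

variable {K : κ → Matrix n n ℂ} {hK : IsRetraction K}

instance : AddCommGroup (FixedAlgebra hK) :=
  inferInstanceAs (AddCommGroup (LinearMap.eqLocus (krausDual K) LinearMap.id))

instance : Module ℂ (FixedAlgebra hK) :=
  inferInstanceAs (Module ℂ (LinearMap.eqLocus (krausDual K) LinearMap.id))

instance : FiniteDimensional ℂ (FixedAlgebra hK) :=
  inferInstanceAs (FiniteDimensional ℂ (LinearMap.eqLocus (krausDual K) LinearMap.id))

/-- The underlying matrix of a fixed point. -/
def val : FixedAlgebra hK →ₗ[ℂ] Matrix n n ℂ := Submodule.subtype _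

theorem val_injective : Function.Injective (val : FixedAlgebra hK → Matrix n n ℂ) :=
  Subtype.val_injective

theorem krausDual_val (a : FixedAlgebra hK) : krausDual K a.val = a.val := a.2

/-- The projection of a matrix onto the fixed points. -/
def proj (hK : IsRetraction K) : Matrix n n ℂ →ₗ[ℂ] FixedAlgebra hK :=
  LinearMap.codRestrict _ (krausDual K) hK.krausDual_idem

theorem val_proj (X : Matrix n n ℂ) : (proj hK X).val = krausDual K X := rfl

theorem proj_val (a : FixedAlgebra hK) : proj hK a.val = a := val_injective a.krausDual_val

instance : Mul (FixedAlgebra hK) := ⟨fun a b => proj hK (a.val * b.val)⟩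

instance : One (FixedAlgebra hK) := ⟨proj hK 1⟩

theorem val_mul (a b : FixedAlgebra hK) : (a * b).val = krausDual K (a.val * b.val) := rfl

theorem val_one : (1 : FixedAlgebra hK).val = 1 := krausDual_one hK.sum_eq_one

instance : Ring (FixedAlgebra hK) :=
  { (inferInstance : AddCommGroup (FixedAlgebra hK)),
    (inferInstance : Mul (FixedAlgebra hK)),
    (inferInstance : One (FixedAlgebra hK)) with
    left_distrib := fun a b c => val_injective (by
      simp only [val_mul, map_add, Matrix.mul_add])
    right_distrib := fun a b c => val_injective (by
      simp only [val_mul, map_add, Matrix.add_mul])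
    zero_mul := fun a => val_injective (by simp only [val_mul, map_zero, Matrix.zero_mul])
    mul_zero := fun a => val_injective (by simp only [val_mul, map_zero, Matrix.mul_zero])
    mul_assoc := fun a b c => val_injective (by
      simp only [val_mul, hK.krausDual_assoc_left a.krausDual_val b.krausDual_val c.krausDual_val,
        hK.krausDual_assoc_right a.krausDual_val b.krausDual_val c.krausDual_val, mul_assoc])
    one_mul := fun a => val_injective (by rw [val_mul, val_one, one_mul, krausDual_val])
    mul_one := fun a => val_injective (by rw [val_mul, val_one, mul_one, krausDual_val]) }

instance : Algebra ℂ (FixedAlgebra hK) :=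
  Algebra.ofModule
    (fun c a b => val_injective (by simp only [val_mul, map_smul, Matrix.smul_mul]))
    (fun c a b => val_injective (by simp only [val_mul, map_smul, Matrix.mul_smul]))

instance : Star (FixedAlgebra hK) := ⟨fun a => proj hK a.val.conjTranspose⟩

theorem val_star (a : FixedAlgebra hK) : (star a).val = a.val.conjTranspose :=
  (krausDual_conjTranspose K a.val).trans (congrArg _ a.krausDual_val)

instance : StarRing (FixedAlgebra hK) where
  star_involutive a := val_injective (by simp only [val_star, Matrix.conjTranspose_conjTranspose])
  star_mul a b := val_injective (by
    simp only [val_star, val_mul, ← krausDual_conjTranspose, Matrix.conjTranspose_mul])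
  star_add a b := val_injective (by simp only [val_star, map_add, Matrix.conjTranspose_add])

instance : StarModule ℂ (FixedAlgebra hK) where
  star_smul c a := val_injective (by simp only [val_star, map_smul, Matrix.conjTranspose_smul])

/-- The trace of the underlying matrix. It is not tracial for the Choi–Effros product. -/
def traceForm (hK : IsRetraction K) : FixedAlgebra hK →ₗ[ℂ] ℂ :=
  Matrix.traceLinearMap n ℂ ℂ ∘ₗ val

theorem isFaithfulPositive_traceForm : IsFaithfulPositive (traceForm hK) := by
  intro a ha
  have h1 := sum_schwarz_defect hK.sum_eq_one a.val a.val a.krausDual_val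
  have h2 : (krausDual K (a.val.conjTranspose * a.val)).trace =
      (∑ i, (a.val * K i - K i * a.val).conjTranspose * (a.val * K i - K i * a.val)).trace
      + (a.val.conjTranspose * a.val).trace := by
    rw [h1, Matrix.trace_sub, sub_add_cancel]
  have h3 : traceForm hK (star a * a) = (krausDual K (a.val.conjTranspose * a.val)).trace := by
    rw [traceForm, LinearMap.comp_apply, val_mul, val_star, Matrix.traceLinearMap_apply]
  rw [h3, h2]
  refine add_pos_of_nonneg_of_pos
    (Matrix.posSemidef_sum _ fun i _ => Matrix.posSemidef_conjTranspose_mul_self _).trace_nonneg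
    (lt_of_le_of_ne (Matrix.posSemidef_conjTranspose_mul_self _).trace_nonneg fun h => ha ?_)
  apply val_injective
  rw [map_zero]
  exact Matrix.trace_conjTranspose_mul_self_eq_zero_iff.mp h.symm

theorem posSemidef_star_mul_self (a : FixedAlgebra hK) : (star a * a).val.PosSemidef := by
  rw [val_mul, val_star]
  exact krausDual_posSemidef K (Matrix.posSemidef_conjTranspose_mul_self _)

theorem posSemidef_of_isStarProjection {e : FixedAlgebra hK} (he : IsStarProjection e) :
    e.val.PosSemidef := by
  have := posSemidef_star_mul_self e
  rwa [he.isSelfAdjoint.star_eq, he.isIdempotentElem.eq] at this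

end FixedAlgebra

/-! ### Tensor products of idempotent channels -/

section Tensor

variable {K : κ → Matrix n n ℂ} {L : μ → Matrix m m ℂ}

theorem krausDual_kronecker (K : κ → Matrix n n ℂ) (L : μ → Matrix m m ℂ) :
    krausDual (fun i : κ × μ => K i.1 ⊗ₖ L i.2) = tensorMap (krausDual K) (krausDual L) := by
  rw [krausDual, krausDual, krausDual, tensorMap_kraus]
  simp only [Matrix.conjTranspose_kronecker]

theorem IsRetraction.kronecker (hK : IsRetraction K) (hL : IsRetraction L) :
    IsRetraction (fun i : κ × μ => K i.1 ⊗ₖ L i.2) where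
  sum_eq_one := sum_conjTranspose_mul_self_kronecker K L hK.sum_eq_one hL.sum_eq_one
  idem X := by
    rw [← tensorMap_kraus]
    refine LinearMap.congr_fun (f := tensorMap (kraus K) (kraus L) ∘ₗ
      tensorMap (kraus K) (kraus L)) (linearMap_ext_kronecker fun A B => ?_) X
    simp only [LinearMap.comp_apply, tensorMap_kronecker, hK.idem, hL.idem]

/-- The elementary tensors in the Choi–Effros algebra of a tensor product. -/
def FixedAlgebra.tensor (hK : IsRetraction K) (hL : IsRetraction L) :
    FixedAlgebra hK →ₗ[ℂ] FixedAlgebra hL →ₗ[ℂ] FixedAlgebra (hK.kronecker hL) :=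
  LinearMap.mk₂ ℂ (fun a b => proj (hK.kronecker hL) (a.val ⊗ₖ b.val))
    (fun a a' b => by rw [map_add, Matrix.add_kronecker, map_add])
    (fun c a b => by rw [map_smul, Matrix.smul_kronecker, map_smul])
    (fun a b b' => by rw [map_add, Matrix.kronecker_add, map_add])
    (fun c a b => by rw [map_smul, Matrix.kronecker_smul, map_smul])

theorem FixedAlgebra.val_tensor (hK : IsRetraction K) (hL : IsRetraction L)
    (a : FixedAlgebra hK) (b : FixedAlgebra hL) : (tensor hK hL a b).val = a.val ⊗ₖ b.val := by
  rw [tensor, LinearMap.mk₂_apply, val_proj, krausDual_kronecker, tensorMap_kronecker,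
    krausDual_val, krausDual_val]

theorem FixedAlgebra.isAlgebraTensor (hK : IsRetraction K) (hL : IsRetraction L) :
    IsAlgebraTensor (tensor hK hL) where
  map_mul a a' b b' := val_injective (by
    rw [val_mul, val_tensor, val_tensor, val_tensor, ← Matrix.mul_kronecker_mul,
      krausDual_kronecker, tensorMap_kronecker, val_mul, val_mul])
  map_star a b := val_injective (by
    rw [val_star, val_tensor, val_tensor, Matrix.conjTranspose_kronecker, val_star, val_star])
  map_one := val_injective (by
    rw [val_tensor, val_one, val_one, val_one, Matrix.one_kronecker_one])
  ne_zero a b ha hb h := by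
    have h1 := congrArg FixedAlgebra.val h
    rw [val_tensor, map_zero] at h1
    have ha' : a.val ≠ 0 := fun h => ha (val_injective (by rw [h, map_zero]))
    have hb' : b.val ≠ 0 := fun h => hb (val_injective (by rw [h, map_zero]))
    obtain ⟨i, j, hij⟩ : ∃ i j, a.val i j ≠ 0 := by
      by_contra! hcon; exact ha' (Matrix.ext hcon)
    obtain ⟨k, l, hkl⟩ : ∃ k l, b.val k l ≠ 0 := by
      by_contra! hcon; exact hb' (Matrix.ext hcon)
    have h2 := congrFun (congrFun h1 (i, k)) (j, l)
    exact mul_ne_zero hij hkl h2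
  span_eq_top := by
    rw [eq_top_iff]
    rintro c -
    rw [← proj_val c]
    obtain ⟨x, hx⟩ := (kroneckerLinearEquiv n n m m ℂ).surjective c.val
    rw [← hx]
    clear hx
    induction x using TensorProduct.induction_on with
    | zero => rw [map_zero, map_zero]; exact Submodule.zero_mem _
    | tmul A B =>
      refine Submodule.subset_span ⟨(proj hK A, proj hL B), val_injective ?_⟩
      rw [val_tensor, val_proj, val_proj, val_proj, krausDual_kronecker,
        kroneckerLinearEquiv_tmul, tensorMap_kronecker]
    | add x y hx hy => rw [map_add, map_add]; exact Submodule.add_mem _ hx hy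

end Tensor

end ChoiEffros

section Codes

variable {n m κ μ ι : Type*} [Fintype n] [DecidableEq n] [Fintype m] [DecidableEq m]
  [Fintype κ] [Fintype μ] [Fintype ι]

/-! ### Perfect transmission -/

theorem trace_mul_eq_zero {A B : Matrix n n ℂ} (hA : A.PosSemidef) (hB : B.PosSemidef)
    (h : (A * B).trace = 0) : A * B = 0 := by
  obtain ⟨a, rfl⟩ := exists_eq_conjTranspose_mul_self hA
  obtain ⟨b, rfl⟩ := exists_eq_conjTranspose_mul_self hB
  have h1 : (a * b.conjTranspose) = 0 := by
    rw [← Matrix.trace_conjTranspose_mul_self_eq_zero_iff, ← h]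
    rw [Matrix.conjTranspose_mul, Matrix.conjTranspose_conjTranspose, Matrix.mul_assoc,
      Matrix.trace_mul_comm]
    simp only [Matrix.mul_assoc]
  rw [Matrix.mul_assoc, ← Matrix.mul_assoc a, h1, Matrix.zero_mul, Matrix.mul_zero]

theorem posSemidef_single (i : n) : (Matrix.single i i (1 : ℂ)).PosSemidef := by
  rw [← Matrix.diagonal_single]
  refine Matrix.PosSemidef.diagonal fun j => ?_
  by_cases hij : j = i <;> simp [hij]

/-- A channel of average fidelity one maps every basis state to a state whose diagonal is that of
the same basis state. -/
theorem diag_of_averageFidelity {D : ℕ}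
    {F : Matrix (Fin D) (Fin D) ℂ →ₗ[ℂ] Matrix (Fin D) (Fin D) ℂ}
    (hF : IsChannel F) (h : 1 - 0 ≤ averageFidelity F) (i j : Fin D) :
    F (Matrix.single i i 1) j j = if i = j then 1 else 0 := by
  have hps : ∀ i, (F (Matrix.single i i 1)).PosSemidef := fun i =>
    hF.posSemidef (posSemidef_single i)
  have hsum : ∀ i, ∑ j, F (Matrix.single i i 1) j j = 1 := fun i => by
    have := hF.2 (Matrix.single i i 1)
    simpa [Matrix.trace] using this
  have hle : ∀ i j, (0 : ℂ) ≤ F (Matrix.single i i 1) j j := fun i j => (hps i).diag_nonneg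
  have hre : ∀ i, ∑ j, (F (Matrix.single i i 1) j j).re = 1 := fun i => by
    have := congrArg Complex.re (hsum i)
    simpa using this
  have hre0 : ∀ i j, 0 ≤ (F (Matrix.single i i 1) j j).re := fun i j =>
    (Complex.nonneg_iff.mp (hle i j)).1
  have hle1 : ∀ i, (F (Matrix.single i i 1) i i).re ≤ 1 := fun i => by
    rw [← hre i]
    exact Finset.single_le_sum (f := fun j => (F (Matrix.single i i 1) j j).re)
      (fun j _ => hre0 i j) (Finset.mem_univ i)
  have hD : (0 : ℝ) < D := by
    have : 0 < D := i.pos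
    exact_mod_cast this
  have heq : ∀ i, (F (Matrix.single i i 1) i i).re = 1 := by
    have h1 : ∑ i : Fin D, (1 : ℝ) ≤ ∑ i, (F (Matrix.single i i 1) i i).re := by
      rw [averageFidelity, sub_zero, one_div, inv_mul_eq_div, le_div_iff₀ hD] at h
      simpa using h
    have h2 : ∑ i, (F (Matrix.single i i 1) i i).re = ∑ i : Fin D, (1 : ℝ) :=
      le_antisymm (Finset.sum_le_sum fun i _ => hle1 i) h1
    intro i
    exact (Finset.sum_eq_sum_iff_of_le fun i _ => hle1 i).mp h2 i (Finset.mem_univ i)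
  have him : (F (Matrix.single i i 1) j j).im = 0 := (Complex.nonneg_iff.mp (hle i j)).2.symm
  by_cases hij : i = j
  · subst hij
    rw [if_pos rfl]
    apply Complex.ext <;> simp [heq, him]
  · rw [if_neg hij]
    have h1 : (F (Matrix.single i i 1) i i).re + (F (Matrix.single i i 1) j j).re
        ≤ ∑ j, (F (Matrix.single i i 1) j j).re := by
      rw [← Finset.sum_pair (f := fun j => (F (Matrix.single i i 1) j j).re) hij]
      exact Finset.sum_le_sum_of_subset_of_nonneg (Finset.subset_univ _)
        fun k _ _ => hre0 i k
    rw [hre, heq] at h1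
    apply Complex.ext
    · exact le_antisymm (by simpa using h1) (hre0 i j)
    · exact him

theorem entanglementFidelity_eq {D : ℕ}
    (F : Matrix (Fin D) (Fin D) ℂ →ₗ[ℂ] Matrix (Fin D) (Fin D) ℂ) :
    entanglementFidelity F = (∑ a, ∑ b, F (Matrix.single a b 1) a b).re / (D : ℝ) ^ 2 := by
  have hs : ((1 / Real.sqrt D : ℝ) : ℂ) * ((1 / Real.sqrt D : ℝ) : ℂ) = ((1 / D : ℝ) : ℂ) := by
    rw [← Complex.ofReal_mul, ← pow_two, div_pow, Real.sq_sqrt (Nat.cast_nonneg D), one_pow]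
  have hsub : ∀ a b : Fin D, (Matrix.vecMulVec (maxEntangled D) (star (maxEntangled D))).submatrix
      (fun x => (a, x)) (fun x => (b, x)) = ((1 / D : ℝ) : ℂ) • Matrix.single a b 1 := by
    intro a b
    ext x y
    rw [Matrix.smul_apply, ← hs]
    simp only [Matrix.submatrix_apply, Matrix.vecMulVec_apply, Pi.star_apply, maxEntangled,
      Matrix.single_apply]
    by_cases h1 : a = x <;> by_cases h2 : b = y <;> simp [h1, h2]
  have hentry : ∀ a b i j : Fin D,
      tensorMap (LinearMap.id : Matrix (Fin D) (Fin D) ℂ →ₗ[ℂ] Matrix (Fin D) (Fin D) ℂ) F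
        (Matrix.vecMulVec (maxEntangled D) (star (maxEntangled D))) (a, i) (b, j)
      = ((1 / D : ℝ) : ℂ) * F (Matrix.single a b 1) i j := by
    intro a b i j
    rw [tensorMap_id_apply, hsub, map_smul, Matrix.smul_apply, smul_eq_mul]
  have hmain : star (maxEntangled D) ⬝ᵥ
      (Matrix.mulVec
        (tensorMap (LinearMap.id : Matrix (Fin D) (Fin D) ℂ →ₗ[ℂ] Matrix (Fin D) (Fin D) ℂ) F
        (Matrix.vecMulVec (maxEntangled D) (star (maxEntangled D)))) (maxEntangled D))
      = ((1 / D : ℝ) : ℂ) * ((1 / D : ℝ) : ℂ) * ∑ a, ∑ b, F (Matrix.single a b 1) a b := by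
    simp only [dotProduct, Matrix.mulVec, Fintype.sum_prod_type, hentry]
    simp only [maxEntangled, Pi.star_apply]
    simp only [apply_ite (star : ℂ → ℂ), star_zero, mul_ite, ite_mul, mul_zero, zero_mul,
      Finset.sum_ite_eq, Finset.mem_univ, if_true]
    rw [Finset.mul_sum]
    refine Finset.sum_congr rfl fun a _ => ?_
    rw [Finset.mul_sum, Finset.mul_sum]
    refine Finset.sum_congr rfl fun b _ => ?_
    rw [← hs]
    simp only [RCLike.star_def, Complex.conj_ofReal]
    ring
  rw [entanglementFidelity, hmain, ← Complex.ofReal_mul, Complex.re_ofReal_mul]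
  rw [div_mul_div_comm, one_mul, div_mul_eq_mul_div, one_mul, pow_two]

theorem entanglementFidelity_id {D : ℕ} (hD : 1 ≤ D) :
    entanglementFidelity
      (LinearMap.id : Matrix (Fin D) (Fin D) ℂ →ₗ[ℂ] Matrix (Fin D) (Fin D) ℂ) = 1 := by
  have : (D : ℝ) ≠ 0 := by positivity
  rw [entanglementFidelity_eq]
  simp [pow_two, this]

/-- A channel of entanglement fidelity one is the identity: its Kraus operators attain equality in
the Cauchy–Schwarz inequality against the identity matrix, so that they are scalars. -/
theorem eq_id_of_entanglementFidelity {D : ℕ} (hD : 1 ≤ D)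
    {F : Matrix (Fin D) (Fin D) ℂ →ₗ[ℂ] Matrix (Fin D) (Fin D) ℂ}
    (hF : IsChannel F) (h : 1 - 0 ≤ entanglementFidelity F) : F = LinearMap.id := by
  obtain ⟨L, rfl, hL⟩ := hF.exists_kraus
  have hD0 : (0 : ℝ) < D := by exact_mod_cast hD
  have hDC : (D : ℂ) ≠ 0 := by exact_mod_cast hD0.ne'
  have hsum : ∑ a, ∑ b, kraus L (Matrix.single a b 1) a b
      = ∑ i, (L i).trace * star (L i).trace := by
    have : ∀ a b, kraus L (Matrix.single a b 1) a b = ∑ i, L i a a * star (L i b b) := by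
      intro a b
      rw [kraus_apply, Matrix.sum_apply]
      refine Finset.sum_congr rfl fun i _ => ?_
      simp [Matrix.mul_apply, Matrix.single_apply, ite_and]
    simp only [this]
    rw [Finset.sum_congr rfl fun _ _ => Finset.sum_comm, Finset.sum_comm]
    refine Finset.sum_congr rfl fun i _ => ?_
    simp only [Matrix.trace, Matrix.diag, star_sum, Finset.sum_mul_sum]
  rw [entanglementFidelity_eq, hsum, sub_zero, le_div_iff₀ (by positivity), one_mul] at h
  set Z := fun i => L i - ((L i).trace / D) • (1 : Matrix (Fin D) (Fin D) ℂ) with hZ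
  have htr : ∀ i, ((Z i).conjTranspose * Z i).trace
      = ((L i).conjTranspose * L i).trace - (L i).trace * star (L i).trace / D := by
    intro i
    simp only [hZ, Matrix.conjTranspose_sub, Matrix.conjTranspose_smul, Matrix.conjTranspose_one,
      Matrix.sub_mul, Matrix.mul_sub, Matrix.smul_mul, Matrix.mul_smul, one_mul, mul_one,
      Matrix.trace_sub, Matrix.trace_smul, Matrix.trace_one, Matrix.trace_conjTranspose,
      Fintype.card_fin, smul_eq_mul, star_div₀, star_natCast]
    field_simp
    ring
  have hZ0 : (∑ i, (Z i).conjTranspose * Z i).trace = 0 := by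
    refine le_antisymm ?_
      (Matrix.posSemidef_sum _ fun i _ => Matrix.posSemidef_conjTranspose_mul_self _).trace_nonneg
    have hone : (1 : Matrix (Fin D) (Fin D) ℂ).trace = D := by simp
    rw [Matrix.trace_sum, Finset.sum_congr rfl fun i _ => htr i, Finset.sum_sub_distrib,
      ← Matrix.trace_sum, hL, hone, ← Finset.sum_div]
    have hreal : ∑ i, (L i).trace * star (L i).trace
        = ((∑ i, (L i).trace * star (L i).trace).re : ℂ) := by
      have : ∀ i, (L i).trace * star (L i).trace = ((Complex.normSq (L i).trace : ℝ) : ℂ) :=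
        fun i => Complex.mul_conj _
      simp only [this, ← Complex.ofReal_sum, Complex.ofReal_re]
    rw [hreal, sub_nonpos, ← Complex.ofReal_natCast, ← Complex.ofReal_div, Complex.real_le_real,
      le_div_iff₀ hD0, ← pow_two]
    exact h
  have hLs : ∀ i, L i = ((L i).trace / D) • (1 : Matrix (Fin D) (Fin D) ℂ) := fun i =>
    sub_eq_zero.mp (eq_zero_of_trace_sum_conjTranspose_mul_self hZ0 i)
  ext1 X
  rw [kraus_apply, LinearMap.id_apply]
  have : ∀ i, L i * X * (L i).conjTranspose = (L i).conjTranspose * L i * X := by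
    intro i
    rw [hLs i]
    simp only [Matrix.conjTranspose_smul, Matrix.conjTranspose_one, Matrix.smul_mul,
      Matrix.mul_smul, one_mul, mul_one]
    exact smul_comm _ _ _
  rw [Finset.sum_congr rfl fun i _ => this i, ← Matrix.sum_mul, hL, one_mul]

/-! ### Upper bounds for codes of an idempotent channel -/

variable {K : κ → Matrix n n ℂ} {hK : IsRetraction K} {e : ι → FixedAlgebra hK}

theorem IsMinimalDecomposition.classical_le (he : IsMinimalDecomposition e) {D : ℕ}
    {E : Matrix (Fin D) (Fin D) ℂ →ₗ[ℂ] Matrix n n ℂ}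
    {R : Matrix n n ℂ →ₗ[ℂ] Matrix (Fin D) (Fin D) ℂ} (hE : IsChannel E) (hR : IsChannel R)
    (h : 1 - 0 ≤ averageFidelity (R ∘ₗ kraus K ∘ₗ E)) : D ≤ Fintype.card ι := by
  have hdiag := diag_of_averageFidelity
    (hR.comp ((isChannel_kraus K hK.sum_eq_one).comp hE)) h
  obtain ⟨L, rfl, hL⟩ := hR.exists_kraus
  set τ : Fin D → Matrix n n ℂ := fun i => kraus K (E (Matrix.single i i 1)) with hτ
  let F : Fin D → FixedAlgebra hK := fun j =>
    FixedAlgebra.proj hK (krausDual L (Matrix.single j j 1))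
  let J : Fin D → Submodule (FixedAlgebra hK) (FixedAlgebra hK) := fun i =>
    { carrier := {a | a.val * τ i = 0}
      add_mem' := fun {a b} ha hb => by
        simp only [Set.mem_ofPred_eq] at ha hb ⊢
        rw [map_add, Matrix.add_mul, ha, hb, add_zero]
      zero_mem' := by
        simp only [Set.mem_ofPred_eq]
        rw [map_zero, Matrix.zero_mul]
      smul_mem' := fun b a ha => by
        simp only [Set.mem_ofPred_eq] at ha ⊢
        rw [smul_eq_mul, FixedAlgebra.val_mul, hτ,
          hK.krausDual_mul_kraus b.krausDual_val a.krausDual_val, Matrix.mul_assoc, ha,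
          Matrix.mul_zero] }
  have htr : ∀ i j, ((F j).val * τ i).trace = if i = j then 1 else 0 := by
    intro i j
    rw [← hdiag i j, FixedAlgebra.val_proj, ← trace_mul_kraus, hτ, hK.idem, ← trace_mul_kraus,
      Matrix.trace_single_mul]
    simp
  refine he.card_le_of_separated FixedAlgebra.isFaithfulPositive_traceForm J F ?_ ?_
  · intro j hj
    have h1 : (F j).val * τ j = 0 := hj
    have h2 := htr j j
    rw [h1] at h2
    simp at h2
  · intro j k hjk
    have h2 := htr k j
    rw [if_neg (Ne.symm hjk)] at h2
    refine trace_mul_eq_zero (krausDual_posSemidef K (krausDual_posSemidef L (posSemidef_single j)))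
      (kraus_posSemidef K (hE.posSemidef (posSemidef_single k))) h2

theorem IsMinimalDecomposition.quantum_le [DecidableEq ι] (he : IsMinimalDecomposition e)
    [∀ i j, Decidable (Linked (e i) (e j))] {D : ℕ} (hD : 1 ≤ D)
    {E : Matrix (Fin D) (Fin D) ℂ →ₗ[ℂ] Matrix n n ℂ}
    {R : Matrix n n ℂ →ₗ[ℂ] Matrix (Fin D) (Fin D) ℂ} (hE : IsChannel E) (hR : IsChannel R)
    (h : 1 - 0 ≤ entanglementFidelity (R ∘ₗ kraus K ∘ₗ E)) :
    ∃ i, D ≤ (Finset.univ.filter fun k => Linked (e k) (e i)).card := by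
  have hP := isChannel_kraus K hK.sum_eq_one
  have hid := eq_id_of_entanglementFidelity hD (hR.comp (hP.comp hE)) h
  -- As `kraus K` is idempotent, it may be absorbed into the decoder as well as into the encoder;
  -- the adjoint of the decoder then takes values in the fixed points.
  obtain ⟨N, hN, hN1⟩ := (hP.comp hE).exists_kraus
  obtain ⟨L, hL, hL1⟩ := (hR.comp hP).exists_kraus
  have hNapp : ∀ X, kraus N X = kraus K (E X) := fun X => by rw [← hN]; rfl
  have hLapp : ∀ X, kraus L X = R (kraus K X) := fun X => by rw [← hL]; rfl
  have hLN : ∀ X, kraus L (kraus N X) = X := fun X => by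
    rw [hLapp, hNapp, hK.idem]
    exact LinearMap.congr_fun hid X
  have hNL : ∀ x, krausDual N (krausDual L x) = x := fun x => by
    refine trace_mul_right_injective fun X => ?_
    rw [← trace_mul_kraus, ← trace_mul_kraus, hLN]
  have hfix : ∀ x, krausDual K (krausDual L x) = krausDual L x := fun x => by
    refine trace_mul_right_injective fun X => ?_
    rw [← trace_mul_kraus, ← trace_mul_kraus, ← trace_mul_kraus, hLapp, hLapp, hK.idem]
  have hNK : ∀ X, krausDual N (krausDual K X) = krausDual N X := fun X => by
    refine trace_mul_right_injective fun Y => ?_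
    rw [← trace_mul_kraus, ← trace_mul_kraus, ← trace_mul_kraus, hNapp, hK.idem]
  -- The Schwarz defect of `krausDual N` is minus the image of that of `krausDual L`. Both are
  -- positive, hence zero.
  have hcomm : ∀ x i, krausDual L x * N i = N i * x := by
    intro x i
    have h1 := sum_schwarz_defect hN1 (krausDual L x) x (hNL x)
    have h2 := sum_schwarz_defect hL1 x (krausDual L x) rfl
    have h3 : krausDual N (∑ i, (x * L i - L i * krausDual L x).conjTranspose
        * (x * L i - L i * krausDual L x)) = - ∑ i, (krausDual L x * N i - N i * x).conjTranspose
        * (krausDual L x * N i - N i * x) := by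
      rw [h1, h2, map_sub, hNL, neg_sub]
    have h4 : (∑ i, (krausDual L x * N i - N i * x).conjTranspose
        * (krausDual L x * N i - N i * x)).trace = 0 := by
      refine le_antisymm ?_ (Matrix.posSemidef_sum _ fun i _ =>
        Matrix.posSemidef_conjTranspose_mul_self _).trace_nonneg
      have h5 := (krausDual_posSemidef N (Matrix.posSemidef_sum Finset.univ fun i _ =>
        Matrix.posSemidef_conjTranspose_mul_self (x * L i - L i * krausDual L x))).trace_nonneg
      rw [h3, Matrix.trace_neg] at h5
      exact neg_nonneg.mp h5
    exact sub_eq_zero.mp (eq_zero_of_trace_sum_conjTranspose_mul_self h4 i)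
  have hcomm' : ∀ x i, (N i).conjTranspose * krausDual L x = x * (N i).conjTranspose := by
    intro x i
    have h1 := congrArg Matrix.conjTranspose (hcomm x.conjTranspose i)
    rwa [krausDual_conjTranspose, Matrix.conjTranspose_mul, Matrix.conjTranspose_mul,
      Matrix.conjTranspose_conjTranspose, Matrix.conjTranspose_conjTranspose] at h1
  let z : Fin D := ⟨0, hD⟩
  let g : FixedAlgebra hK →ₗ[ℂ] (Fin D → ℂ) :=
    (Matrix.mulVecBilin ℂ ℂ).flip (Pi.single z 1) ∘ₗ krausDual N ∘ₗ FixedAlgebra.val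
  have hg : ∀ a, g a = (krausDual N a.val).mulVec (Pi.single z 1) := fun a => rfl
  refine he.exists_le_card_linked FixedAlgebra.isFaithfulPositive_traceForm g ?_ ?_
  · intro h0
    have h1 := congrFun (LinearMap.congr_fun h0 1) z
    rw [hg, FixedAlgebra.val_one, krausDual_one hN1] at h1
    simp at h1
  · intro x
    refine ⟨FixedAlgebra.proj hK (krausDual L x), fun a => ?_⟩
    rw [hg, hg, FixedAlgebra.val_mul, FixedAlgebra.val_proj, hfix, hNK, Matrix.mulVec_mulVec]
    congr 1
    simp only [krausDual_apply N, Matrix.mul_sum]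
    refine Finset.sum_congr rfl fun i _ => ?_
    rw [← Matrix.mul_assoc, hcomm']
    simp only [Matrix.mul_assoc]

end Codes

section Codes

variable {n κ ι : Type*} [Fintype n] [DecidableEq n] [Fintype κ] [Fintype ι]

/-! ### Codes for an idempotent channel -/

variable {K : κ → Matrix n n ℂ} {hK : IsRetraction K} {e : ι → FixedAlgebra hK}

/-- Every nonzero projection of the Choi–Effros algebra fixes a unit vector (encoded as a column
matrix) on which the Choi–Effros product acts like the matrix product. -/
theorem exists_unit_column {p : FixedAlgebra hK} (hp : IsStarProjection p) (hp0 : p ≠ 0) :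
    ∃ w : Matrix n Unit ℂ, w.conjTranspose * w = 1 ∧ p.val * w = w ∧
      ∀ a b c : FixedAlgebra hK, (a * b).val * (c.val * w) = a.val * (b.val * (c.val * w)) := by
  have hpp : p * p = p := hp.isIdempotentElem.eq
  obtain ⟨i, j, k, hijk⟩ : ∃ i j k, p.val * (K i * K j * K k) ≠ 0 := by
    by_contra! hcon
    apply hp0
    apply FixedAlgebra.val_injective
    rw [← hpp, FixedAlgebra.val_mul, hK.krausDual_eq_sum, map_zero]
    simp only [Matrix.mul_assoc p.val, hcon, Matrix.mul_zero, Finset.sum_const_zero]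
  set G := K i * K j * K k with hG
  obtain ⟨x, y, hxy⟩ : ∃ x y, (p.val * G) x y ≠ 0 := by
    by_contra! hcon
    exact hijk (Matrix.ext hcon)
  let ζ : Matrix n Unit ℂ := Matrix.of fun z _ => if z = y then 1 else 0
  set H := G * ζ with hH
  have hmul : ∀ a b c : FixedAlgebra hK,
      (a * b).val * (c.val * H) = a.val * (b.val * (c.val * H)) := fun a b c => by
    have h := hK.krausDual_mul_mul a.krausDual_val b.krausDual_val c.krausDual_val i j k
    rw [← hG] at h
    simpa only [Matrix.mul_assoc, FixedAlgebra.val_mul, hH] using congrArg (fun Z => Z * ζ) h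
  have hmul' : ∀ a b : FixedAlgebra hK, (a * b).val * H = a.val * (b.val * H) := fun a b => by
    have := hmul a b 1
    rwa [FixedAlgebra.val_one, Matrix.one_mul] at this
  set w₀ : Matrix n Unit ℂ := p.val * H with hw₀
  have hw₀0 : w₀ ≠ 0 := by
    intro h
    apply hxy
    have h1 := congrFun (congrFun h x) ()
    rw [hw₀, hH, ← Matrix.mul_assoc, Matrix.mul_apply] at h1
    simpa [ζ] using h1
  have hpos : 0 < (w₀.conjTranspose * w₀).trace := by
    refine lt_of_le_of_ne (Matrix.posSemidef_conjTranspose_mul_self w₀).trace_nonneg fun h => ?_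
    exact hw₀0 (Matrix.trace_conjTranspose_mul_self_eq_zero_iff.mp h.symm)
  set r := (w₀.conjTranspose * w₀).trace.re with hr
  have hr0 : 0 < r := (Complex.pos_iff.mp hpos).1
  have hrw : (w₀.conjTranspose * w₀) () () = r := by
    have h1 : (w₀.conjTranspose * w₀).trace = (w₀.conjTranspose * w₀) () () := by
      simp [Matrix.trace]
    rw [← h1]
    apply Complex.ext
    · simp [hr]
    · simp [(Complex.pos_iff.mp hpos).2.symm]
  set s : ℂ := (((Real.sqrt r)⁻¹ : ℝ) : ℂ) with hs
  have hss : star s = s := by simp [hs]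
  have hsr : s * (s * r) = 1 := by
    rw [hs]
    norm_cast
    rw [← mul_assoc, ← mul_inv, Real.mul_self_sqrt hr0.le, inv_mul_cancel₀ hr0.ne']
  refine ⟨s • w₀, ?_, ?_, ?_⟩
  · ext u v
    rw [Matrix.conjTranspose_smul, Matrix.smul_mul, Matrix.mul_smul, hss, Matrix.smul_apply,
      Matrix.smul_apply, hrw, smul_eq_mul, smul_eq_mul, hsr]
    rfl
  · rw [Matrix.mul_smul, hw₀, ← hmul', hpp]
  · intro a b c
    simp only [Matrix.mul_smul]
    rw [hw₀, ← hmul' c p, hmul]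

/-- Preparing states in the ranges of the minimal projections and measuring the projections is a
perfect classical code. -/
theorem IsMinimalDecomposition.exists_classicalCode (he : IsMinimalDecomposition e) {D : ℕ}
    (hD : 1 ≤ D) (f : Fin D ≃ ι) :
    ∃ (E : Matrix (Fin D) (Fin D) ℂ →ₗ[ℂ] Matrix n n ℂ)
      (R : Matrix n n ℂ →ₗ[ℂ] Matrix (Fin D) (Fin D) ℂ), IsChannel E ∧ IsChannel R ∧
      1 - 0 ≤ averageFidelity (R ∘ₗ kraus K ∘ₗ E) := by
  choose w hw1 hw2 hw3 using fun i =>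
    exists_unit_column (he.isStarProjection (f i)) (he.ne_zero (f i))
  choose B hB using fun i => exists_eq_conjTranspose_mul_self
    (FixedAlgebra.posSemidef_of_isStarProjection (he.isStarProjection (f i)))
  let δ : Fin D → Matrix Unit (Fin D) ℂ := fun i => Matrix.single () i 1
  let W : Fin D → Matrix n (Fin D) ℂ := fun i => w i * δ i
  let V : Fin D × n → Matrix (Fin D) n ℂ := fun x => Matrix.single x.1 x.2 (1 : ℂ) * B x.1
  have hδ : ∀ i, (δ i).conjTranspose * δ i = Matrix.single i i 1 := fun i => by
    simp [δ, Matrix.conjTranspose_single]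
  have hW : ∑ i, (W i).conjTranspose * W i = 1 := by
    have : ∀ i, (W i).conjTranspose * W i = Matrix.single i i 1 := fun i => by
      rw [← hδ, Matrix.conjTranspose_mul, Matrix.mul_assoc, ← Matrix.mul_assoc (w i).conjTranspose,
        hw1, Matrix.one_mul]
    simp only [this]
    exact Matrix.sum_single_one
  have hVV : ∀ i, ∑ x, (V (i, x)).conjTranspose * V (i, x) = (e (f i)).val := fun i => by
    have : ∀ x, (V (i, x)).conjTranspose * V (i, x)
        = (B i).conjTranspose * (Matrix.single x x 1 * B i) := fun x => by
      simp only [V, Matrix.conjTranspose_mul, Matrix.conjTranspose_single, star_one]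
      rw [Matrix.mul_assoc, ← Matrix.mul_assoc (Matrix.single x i 1),
        Matrix.single_mul_single_same, one_mul]
    simp only [this]
    rw [← Matrix.mul_sum, ← Matrix.sum_mul, Matrix.sum_single_one, one_mul, ← hB]
  have hV : ∑ x, (V x).conjTranspose * V x = 1 := by
    rw [Fintype.sum_prod_type]
    simp only [hVV]
    rw [f.sum_comp fun i => (e i).val, ← map_sum, he.sum_eq_one, FixedAlgebra.val_one]
  have hdual : ∀ i, krausDual V (Matrix.single i i 1) = (e (f i)).val := fun i => by
    rw [krausDual_apply, Fintype.sum_prod_type, Finset.sum_eq_single i]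
    · rw [← hVV]
      refine Finset.sum_congr rfl fun x _ => ?_
      rw [Matrix.mul_assoc]
      congr 1
      simp only [V]
      rw [← Matrix.mul_assoc, Matrix.single_mul_single_same, one_mul]
    · intro j _ hj
      refine Finset.sum_eq_zero fun x _ => ?_
      rw [Matrix.mul_assoc]
      simp only [V]
      rw [← Matrix.mul_assoc (Matrix.single i i 1), Matrix.single_mul_single_of_ne _ _ _ _ hj.symm,
        Matrix.zero_mul, Matrix.mul_zero]
    · simp
  have hWi : ∀ i, kraus W (Matrix.single i i 1) = w i * (w i).conjTranspose := fun i => by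
    rw [kraus_apply, Finset.sum_eq_single i]
    · simp only [W, δ, Matrix.conjTranspose_mul, Matrix.conjTranspose_single, star_one,
        Matrix.mul_assoc, Matrix.single_mul_single_same, one_mul]
      rw [← Matrix.mul_assoc (Matrix.single () i 1), Matrix.single_mul_single_same]
      have : Matrix.single () () (1 * 1 : ℂ) = 1 := by ext; simp
      rw [this, Matrix.one_mul]
    · intro j _ hj
      simp only [W, δ]
      rw [Matrix.mul_assoc (w j), Matrix.single_mul_single_of_ne _ _ _ _ hj, Matrix.mul_zero,
        Matrix.zero_mul]
    · simp
  refine ⟨kraus W, kraus V, isChannel_kraus W hW, isChannel_kraus V hV, ?_⟩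
  have hone : ∀ i, (kraus V ∘ₗ kraus K ∘ₗ kraus W) (Matrix.single i i 1) i i = 1 := fun i => by
    have h1 := trace_mul_kraus V (Matrix.single i i 1) (kraus K (kraus W (Matrix.single i i 1)))
    rw [hdual, trace_mul_kraus K, FixedAlgebra.krausDual_val, hWi, ← Matrix.mul_assoc,
      hw2, Matrix.trace_mul_comm (w i), hw1, Matrix.trace_single_mul, ← hWi] at h1
    simpa using h1
  have hD0 : (D : ℝ) ≠ 0 := by positivity
  rw [averageFidelity]
  simp [hone, hD0]

/-- Pairwise linked minimal projections `e (f k)` give matrix units `star (u k) * u l`, hence a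
perfect quantum code. -/
theorem IsMinimalDecomposition.exists_quantumCode (he : IsMinimalDecomposition e) {D : ℕ}
    (hD : 1 ≤ D) (i : ι) (f : Fin D → ι) (hf : Function.Injective f)
    (hlink : ∀ k, Linked (e (f k)) (e i)) :
    ∃ (E : Matrix (Fin D) (Fin D) ℂ →ₗ[ℂ] Matrix n n ℂ)
      (R : Matrix n n ℂ →ₗ[ℂ] Matrix (Fin D) (Fin D) ℂ), IsChannel E ∧ IsChannel R ∧
      1 - 0 ≤ entanglementFidelity (R ∘ₗ kraus K ∘ₗ E) := by
  classical
  choose u hu1 hu2 hu3 hu4 using fun k =>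
    he.exists_partialIsometry FixedAlgebra.isFaithfulPositive_traceForm
      (he.linked_symm (hlink k))
  have huu : ∀ k l, u k * star (u l) = if k = l then e i else 0 := by
    intro k l
    by_cases hkl : k = l
    · rw [if_pos hkl, hkl, hu3]
    · have h1 : e (f l) * star (u l) = star (u l) := by
        have := congrArg star (hu2 l)
        rwa [star_mul, he.star_eq] at this
      rw [if_neg hkl, ← hu2 k, ← h1, mul_assoc, ← mul_assoc (e (f k)),
        he.mul_eq_zero _ _ fun h => hkl (hf h), zero_mul, mul_zero]
  obtain ⟨w, hw1, hw2, hw3⟩ := exists_unit_column (he.isStarProjection i) (he.ne_zero i)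
  have hw4 : ∀ a b : FixedAlgebra hK, (a * b).val * w = a.val * (b.val * w) := fun a b => by
    have := hw3 a b 1
    rwa [FixedAlgebra.val_one, Matrix.one_mul] at this
  -- The code space is spanned by the orthonormal vectors `star (u k) * w`.
  let δ : Fin D → Matrix Unit (Fin D) ℂ := fun k => Matrix.single () k 1
  obtain ⟨M, hM⟩ : ∃ M : Matrix n (Fin D) ℂ, M = ∑ k, (star (u k)).val * w * δ k := ⟨_, rfl⟩
  have hunit : ∀ k l, (star (u k) * u l).val * M = (star (u k)).val * w * δ l := by
    intro k l
    rw [hM, Matrix.mul_sum, Finset.sum_eq_single l]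
    · rw [← Matrix.mul_assoc, hw3, ← hw4 (u l), huu, if_pos rfl, hw2]
    · intro m _ hm
      rw [← Matrix.mul_assoc, hw3, ← hw4 (u l), huu, if_neg hm.symm, map_zero, Matrix.zero_mul,
        Matrix.mul_zero, Matrix.zero_mul]
    · simp
  have hadj : M.conjTranspose = ∑ k, (δ k).conjTranspose * (w.conjTranspose * (u k).val) := by
    rw [hM, Matrix.conjTranspose_sum]
    simp only [Matrix.conjTranspose_mul, FixedAlgebra.val_star, Matrix.conjTranspose_conjTranspose]
  have hMu : ∀ k, M.conjTranspose * ((star (u k)).val * w) = (δ k).conjTranspose := by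
    intro k
    rw [hadj, Matrix.sum_mul, Finset.sum_eq_single k]
    · rw [Matrix.mul_assoc, Matrix.mul_assoc w.conjTranspose, ← hw4, huu, if_pos rfl, hw2, hw1,
        Matrix.mul_one]
    · intro l _ hl
      rw [Matrix.mul_assoc, Matrix.mul_assoc w.conjTranspose, ← hw4, huu, if_neg hl, map_zero,
        Matrix.zero_mul, Matrix.mul_zero, Matrix.mul_zero]
    · simp
  have hδ : ∀ k l, (δ k).conjTranspose * δ l = Matrix.single k l 1 := fun k l => by
    simp [δ, Matrix.conjTranspose_single]
  have hMM : M.conjTranspose * M = 1 := by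
    refine (congrArg (M.conjTranspose * ·) hM).trans ?_
    rw [Matrix.mul_sum, ← Matrix.sum_single_one]
    refine Finset.sum_congr rfl fun k _ => ?_
    rw [← Matrix.mul_assoc, hMu, hδ]
  have hMuM : ∀ k l, M.conjTranspose * ((star (u k) * u l).val * M) = Matrix.single k l 1 := by
    intro k l
    rw [hunit, ← Matrix.mul_assoc, hMu, hδ]
  -- The projection onto the complement of the code space.
  obtain ⟨C, hC⟩ : ∃ C : Matrix n n ℂ,
      (1 - ∑ k, star (u k) * u k).val = C.conjTranspose * C := by
    apply exists_eq_conjTranspose_mul_self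
    have h1 : (1 : FixedAlgebra hK) - ∑ k, star (u k) * u k
        = ∑ j ∈ Finset.univ \ Finset.univ.image f, e j := by
      rw [sub_eq_iff_eq_add, ← he.sum_eq_one,
        ← Finset.sum_sdiff (Finset.subset_univ (Finset.univ.image f)),
        Finset.sum_image fun x _ y _ h => hf h]
      simp only [hu4]
    rw [h1, map_sum]
    exact Matrix.posSemidef_sum _ fun j _ =>
      FixedAlgebra.posSemidef_of_isStarProjection (he.isStarProjection j)
  set r : ℂ := (((Real.sqrt D)⁻¹ : ℝ) : ℂ) with hr
  have hrr : star r * r * D = 1 := by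
    have : (0 : ℝ) < D := by exact_mod_cast hD
    rw [hr]
    simp only [RCLike.star_def, Complex.conj_ofReal]
    norm_cast
    rw [← mul_inv, Real.mul_self_sqrt this.le, inv_mul_cancel₀ this.ne']
  -- Kraus operators for the decoding: the first family undoes the encoding, the second one takes
  -- care of the complement.
  let V₁ : n × κ → Matrix (Fin D) n ℂ := fun x =>
    (Matrix.of fun k y => (u k).val x.1 y) * K x.2
  let V₂ : Fin D × n → Matrix (Fin D) n ℂ := fun x => r • (Matrix.single x.1 x.2 (1 : ℂ) * C)
  let V : (n × κ) ⊕ (Fin D × n) → Matrix (Fin D) n ℂ := Sum.elim V₁ V₂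
  have hdual₁ : ∀ Y, krausDual V₁ Y = ∑ k, ∑ l, Y k l • (star (u k) * u l).val := by
    intro Y
    have h1 : ∑ x : n, (Matrix.of fun k y => (u k).val x y).conjTranspose * Y
        * (Matrix.of fun k y => (u k).val x y)
        = ∑ k, ∑ l, Y k l • ((u k).val.conjTranspose * (u l).val) := by
      ext a b
      simp only [Matrix.sum_apply, Matrix.mul_apply, Matrix.smul_apply, Matrix.conjTranspose_apply,
        Matrix.of_apply, Finset.sum_mul, smul_eq_mul, Finset.mul_sum]
      rw [Finset.sum_congr rfl fun _ _ => Finset.sum_comm, Finset.sum_comm]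
      refine Finset.sum_congr rfl fun k _ => ?_
      rw [Finset.sum_comm]
      refine Finset.sum_congr rfl fun l _ => Finset.sum_congr rfl fun x _ => ?_
      ring
    have h2 : krausDual V₁ Y = krausDual K (∑ x : n,
        (Matrix.of fun k y => (u k).val x y).conjTranspose * Y
        * (Matrix.of fun k y => (u k).val x y)) := by
      rw [krausDual_apply, krausDual_apply, Fintype.sum_prod_type_right]
      simp only [V₁, Matrix.mul_sum, Matrix.sum_mul, Matrix.conjTranspose_mul, Matrix.mul_assoc]
    rw [h2, h1]
    simp only [map_sum, map_smul, FixedAlgebra.val_mul, FixedAlgebra.val_star]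
  have hdual₂ : ∀ Y, krausDual V₂ Y
      = (star r * r * Y.trace) • (1 - ∑ k, star (u k) * u k).val := by
    intro Y
    have h1 : ∀ x : Fin D × n, (V₂ x).conjTranspose * Y * V₂ x = (star r * r * Y x.1 x.1) •
        (C.conjTranspose * (Matrix.single x.2 x.2 1 * C)) := by
      intro x
      have h2 : Matrix.single x.2 x.1 (1 : ℂ) * Y * Matrix.single x.1 x.2 (1 : ℂ)
          = Y x.1 x.1 • Matrix.single x.2 x.2 (1 : ℂ) := by
        rw [Matrix.single_mul_mul_single]
        simp
      have h3 : (V₂ x).conjTranspose * Y * V₂ x = (star r * r) • (C.conjTranspose *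
          (Matrix.single x.2 x.1 (1 : ℂ) * Y * Matrix.single x.1 x.2 (1 : ℂ) * C)) := by
        simp only [V₂, Matrix.conjTranspose_smul, Matrix.conjTranspose_mul,
          Matrix.conjTranspose_single, star_one, Matrix.smul_mul, Matrix.mul_smul, smul_smul,
          Matrix.mul_assoc]
        rw [mul_comm]
      rw [h3, h2, Matrix.smul_mul, Matrix.mul_smul, smul_smul]
    rw [krausDual_apply, Finset.sum_congr rfl fun x _ => h1 x, Fintype.sum_prod_type, hC]
    simp only [← Finset.smul_sum, ← Matrix.mul_sum, ← Matrix.sum_mul, Matrix.sum_single_one,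
      Matrix.one_mul]
    rw [← Finset.sum_smul, ← Finset.mul_sum]
    rfl
  have hdual : ∀ Y, krausDual V Y = ((∑ k, ∑ l, Y k l • (star (u k) * u l)) +
      (star r * r * Y.trace) • (1 - ∑ k, star (u k) * u k)).val := by
    intro Y
    rw [map_add, map_smul, ← hdual₂]
    simp only [map_sum, map_smul]
    rw [← hdual₁, krausDual_apply, krausDual_apply, krausDual_apply, Fintype.sum_sum_type]
    rfl
  have hV : ∑ x, (V x).conjTranspose * V x = 1 := by
    have h1 := hdual 1
    rw [krausDual_apply, Matrix.trace_one, Fintype.card_fin, hrr, one_smul] at h1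
    have h2 : ∑ k, ∑ l, (1 : Matrix (Fin D) (Fin D) ℂ) k l • (star (u k) * u l)
        = ∑ k, star (u k) * u k := by
      refine Finset.sum_congr rfl fun k _ => ?_
      simp [Matrix.one_apply]
    rw [h2, add_sub_cancel, FixedAlgebra.val_one] at h1
    simpa using h1
  have hMch : ∑ _x : Unit, M.conjTranspose * M = 1 := by simpa using hMM
  refine ⟨kraus fun _ : Unit => M, kraus V, isChannel_kraus _ hMch, isChannel_kraus V hV, ?_⟩
  have hid : kraus V ∘ₗ kraus K ∘ₗ kraus (fun _ : Unit => M) = LinearMap.id := by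
    ext1 X
    refine trace_mul_right_injective fun Y => ?_
    have h1 : M.conjTranspose * krausDual V Y * M = Y := by
      have h2 : M.conjTranspose * (1 - ∑ k, star (u k) * u k).val * M = 0 := by
        rw [map_sub, map_sum, Matrix.mul_sub, Matrix.sub_mul, FixedAlgebra.val_one, Matrix.mul_one,
          hMM, Matrix.mul_sum, Matrix.sum_mul]
        simp only [Matrix.mul_assoc, hMuM, Matrix.sum_single_one, sub_self]
      rw [hdual, map_add, map_smul, Matrix.mul_add, Matrix.add_mul, Matrix.mul_smul,
        Matrix.smul_mul, h2, smul_zero, add_zero]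
      simp only [map_sum, map_smul, Matrix.mul_sum, Matrix.sum_mul, Matrix.mul_smul,
        Matrix.smul_mul, Matrix.mul_assoc, hMuM]
      conv_rhs => rw [Matrix.matrix_eq_sum_single Y]
      simp
    have hfixV : krausDual K (krausDual V Y) = krausDual V Y := by
      rw [hdual, FixedAlgebra.krausDual_val]
    simp only [LinearMap.comp_apply, LinearMap.id_apply]
    rw [Matrix.trace_mul_comm, trace_mul_kraus, trace_mul_kraus, hfixV, trace_mul_kraus,
      krausDual_apply]
    simp only [Finset.univ_unique, Finset.sum_singleton, h1]
    rw [Matrix.trace_mul_comm]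
  rw [hid, entanglementFidelity_id hD, sub_zero]

end Codes

section Limits

variable {n m p q : Type*} [Fintype n] [DecidableEq n] [Fintype m] [DecidableEq m]
  [Fintype p] [DecidableEq p] [Fintype q] [DecidableEq q]

/-! ### Compactness of the set of channels -/

theorem norm_apply_le_trace {A : Matrix n n ℂ} (hA : A.PosSemidef) (i j : n) :
    ‖A i j‖ ≤ A.trace.re := by
  obtain ⟨B, rfl⟩ := exists_eq_conjTranspose_mul_self hA
  have hdiag : ∀ i, ((B.conjTranspose * B) i i).re = ∑ k, ‖B k i‖ ^ 2 := fun i => by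
    simp [Matrix.mul_apply, Complex.sq_norm, Complex.normSq_apply]
  have hle : ∀ i, ∑ k, ‖B k i‖ ^ 2 ≤ (B.conjTranspose * B).trace.re := fun i => by
    rw [Matrix.trace, Complex.re_sum]
    simp only [Matrix.diag, hdiag]
    exact Finset.single_le_sum (f := fun i => ∑ k, ‖B k i‖ ^ 2)
      (fun i _ => Finset.sum_nonneg fun k _ => sq_nonneg _) (Finset.mem_univ i)
  have h1 : ‖(B.conjTranspose * B) i j‖ ≤ ∑ k, (‖B k i‖ ^ 2 + ‖B k j‖ ^ 2) / 2 := by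
    rw [Matrix.mul_apply]
    refine (norm_sum_le _ _).trans (Finset.sum_le_sum fun k _ => ?_)
    rw [norm_mul, Matrix.conjTranspose_apply, norm_star]
    nlinarith [sq_nonneg (‖B k i‖ - ‖B k j‖)]
  rw [← Finset.sum_div, Finset.sum_add_distrib] at h1
  linarith [hle i, hle j]

theorem span_posSemidef : Submodule.span ℂ {A : Matrix n n ℂ | A.PosSemidef} = ⊤ := by
  open scoped MatrixOrder Matrix.Norms.L2Operator in
  have h : {A : Matrix n n ℂ | A.PosSemidef} = {A | 0 ≤ A} :=
    Set.ext fun A => (Matrix.nonneg_iff_posSemidef (A := A)).symm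
  rw [h]
  exact CStarAlgebra.span_nonneg

/-- The entries of the images of a matrix under all channels are uniformly bounded. -/
theorem exists_bound_channel (X : Matrix n n ℂ) : ∃ C : ℝ,
    ∀ T : Matrix n n ℂ →ₗ[ℂ] Matrix m m ℂ, IsChannel T → ∀ i j, ‖T X i j‖ ≤ C := by
  have hX : X ∈ Submodule.span ℂ {A : Matrix n n ℂ | A.PosSemidef} := by
    rw [span_posSemidef]; trivial
  induction hX using Submodule.span_induction with
  | mem A hA =>
    refine ⟨A.trace.re, fun T hT i j => ?_⟩
    rw [← hT.2 A]
    exact norm_apply_le_trace (hT.posSemidef hA) i j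
  | zero => exact ⟨0, fun T _ i j => by simp⟩
  | add A B _ _ hA hB =>
    obtain ⟨C, hC⟩ := hA
    obtain ⟨C', hC'⟩ := hB
    refine ⟨C + C', fun T hT i j => ?_⟩
    rw [map_add, Matrix.add_apply]
    exact norm_add_le_of_le (hC T hT i j) (hC' T hT i j)
  | smul c A _ hA =>
    obtain ⟨C, hC⟩ := hA
    refine ⟨‖c‖ * C, fun T hT i j => ?_⟩
    rw [map_smul, Matrix.smul_apply, norm_smul]
    exact mul_le_mul_of_nonneg_left (hC T hT i j) (norm_nonneg c)

/-- Pointwise convergence of a sequence of linear maps between matrix algebras. -/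
def TendstoMap (F : ℕ → Matrix n n ℂ →ₗ[ℂ] Matrix m m ℂ)
    (G : Matrix n n ℂ →ₗ[ℂ] Matrix m m ℂ) : Prop :=
  ∀ X, Tendsto (fun k => F k X) atTop (𝓝 (G X))

theorem tendsto_matrix_iff {F : ℕ → Matrix n m ℂ} {A : Matrix n m ℂ} :
    Tendsto F atTop (𝓝 A) ↔ ∀ i j, Tendsto (fun k => F k i j) atTop (𝓝 (A i j)) := by
  refine tendsto_pi_nhds.trans (forall_congr' fun i => tendsto_pi_nhds)

theorem TendstoMap.apply {F : ℕ → Matrix n n ℂ →ₗ[ℂ] Matrix m m ℂ}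
    {G : Matrix n n ℂ →ₗ[ℂ] Matrix m m ℂ} (h : TendstoMap F G) (X : Matrix n n ℂ) (i j : m) :
    Tendsto (fun k => F k X i j) atTop (𝓝 (G X i j)) :=
  tendsto_matrix_iff.mp (h X) i j

theorem TendstoMap.unique {F : ℕ → Matrix n n ℂ →ₗ[ℂ] Matrix m m ℂ}
    {G G' : Matrix n n ℂ →ₗ[ℂ] Matrix m m ℂ} (h : TendstoMap F G) (h' : TendstoMap F G') :
    G = G' :=
  LinearMap.ext fun X => tendsto_nhds_unique (h X) (h' X)

theorem TendstoMap.subseq {F : ℕ → Matrix n n ℂ →ₗ[ℂ] Matrix m m ℂ}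
    {G : Matrix n n ℂ →ₗ[ℂ] Matrix m m ℂ} (h : TendstoMap F G) {φ : ℕ → ℕ}
    (hφ : Tendsto φ atTop atTop) : TendstoMap (fun k => F (φ k)) G :=
  fun X => (h X).comp hφ

theorem linearMap_apply_eq_sum (F : Matrix n n ℂ →ₗ[ℂ] Matrix m m ℂ) (X : Matrix n n ℂ) :
    F X = ∑ a, ∑ b, X a b • F (Matrix.single a b 1) := by
  conv_lhs => rw [Matrix.matrix_eq_sum_single X]
  simp only [map_sum]
  refine Finset.sum_congr rfl fun a _ => Finset.sum_congr rfl fun b _ => ?_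
  rw [← map_smul]
  simp

theorem TendstoMap.of_single {F : ℕ → Matrix n n ℂ →ₗ[ℂ] Matrix m m ℂ}
    {G : Matrix n n ℂ →ₗ[ℂ] Matrix m m ℂ}
    (h : ∀ a b i j, Tendsto (fun k => F k (Matrix.single a b 1) i j) atTop
      (𝓝 (G (Matrix.single a b 1) i j))) : TendstoMap F G := by
  intro X
  refine tendsto_matrix_iff.mpr fun i j => ?_
  simp only [linearMap_apply_eq_sum _ X, Matrix.sum_apply, Matrix.smul_apply, smul_eq_mul]
  exact tendsto_finsetSum _ fun a _ => tendsto_finsetSum _ fun b _ =>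
    (h a b i j).const_mul (X a b)

theorem TendstoMap.comp {F : ℕ → Matrix n n ℂ →ₗ[ℂ] Matrix m m ℂ}
    {G : Matrix n n ℂ →ₗ[ℂ] Matrix m m ℂ} {F' : ℕ → Matrix m m ℂ →ₗ[ℂ] Matrix p p ℂ}
    {G' : Matrix m m ℂ →ₗ[ℂ] Matrix p p ℂ} (h' : TendstoMap F' G') (h : TendstoMap F G) :
    TendstoMap (fun k => F' k ∘ₗ F k) (G' ∘ₗ G) := by
  intro X
  refine tendsto_matrix_iff.mpr fun i j => ?_
  simp only [LinearMap.comp_apply]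
  rw [linearMap_apply_eq_sum G' (G X)]
  simp only [fun k => linearMap_apply_eq_sum (F' k) (F k X), Matrix.sum_apply, Matrix.smul_apply,
    smul_eq_mul]
  exact tendsto_finsetSum _ fun a _ => tendsto_finsetSum _ fun b _ =>
    (h.apply X a b).mul (h'.apply _ i j)

theorem TendstoMap.tensorMap {F : ℕ → Matrix n n ℂ →ₗ[ℂ] Matrix m m ℂ}
    {G : Matrix n n ℂ →ₗ[ℂ] Matrix m m ℂ} {F' : ℕ → Matrix p p ℂ →ₗ[ℂ] Matrix q q ℂ}
    {G' : Matrix p p ℂ →ₗ[ℂ] Matrix q q ℂ} (h : TendstoMap F G) (h' : TendstoMap F' G') :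
    TendstoMap (fun k => tensorMap (F k) (F' k)) (tensorMap G G') := by
  refine TendstoMap.of_single fun a b i j => ?_
  have hs : Matrix.single a b (1 : ℂ) = Matrix.single a.1 b.1 1 ⊗ₖ Matrix.single a.2 b.2 1 := by
    simp [Matrix.single_kronecker_single]
  rw [hs]
  simp only [tensorMap_kronecker]
  exact (h.apply _ _ _).mul (h'.apply _ _ _)

theorem posSemidef_of_tendsto {F : ℕ → Matrix n n ℂ} {A : Matrix n n ℂ}
    (h : Tendsto F atTop (𝓝 A)) (hF : ∀ k, (F k).PosSemidef) : A.PosSemidef := by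
  refine Matrix.PosSemidef.of_dotProduct_mulVec_nonneg ?_ fun x => ?_
  · have h1 : Tendsto (fun k => (F k).conjTranspose) atTop (𝓝 A.conjTranspose) :=
      ((continuous_id.matrix_conjTranspose).tendsto A).comp h
    simp only [fun k => (hF k).isHermitian.eq] at h1
    exact tendsto_nhds_unique h1 h
  · have hc : Continuous fun M : Matrix n n ℂ => star x ⬝ᵥ M.mulVec x :=
      continuous_const.dotProduct (continuous_id.matrix_mulVec continuous_const)
    exact ge_of_tendsto' ((hc.tendsto A).comp h) fun k => (hF k).dotProduct_mulVec_nonneg x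

theorem TendstoMap.isChannel {F : ℕ → Matrix n n ℂ →ₗ[ℂ] Matrix m m ℂ}
    {G : Matrix n n ℂ →ₗ[ℂ] Matrix m m ℂ} (h : TendstoMap F G) (hF : ∀ k, IsChannel (F k)) :
    IsChannel G := by
  refine ⟨fun k X hX => ?_, fun X => ?_⟩
  · refine posSemidef_of_tendsto (F := fun l => InfiniteTime.tensorMap
      (LinearMap.id : Matrix (Fin k) (Fin k) ℂ →ₗ[ℂ] Matrix (Fin k) (Fin k) ℂ) (F l) X) ?_
      fun l => (hF l).1 k X hX
    exact (TendstoMap.tensorMap (F := fun _ => LinearMap.id) (fun _ => tendsto_const_nhds) h) X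
  · have h1 : Tendsto (fun k => (F k X).trace) atTop (𝓝 (G X).trace) :=
      ((continuous_id.matrix_trace).tendsto _).comp (h X)
    simp only [fun k => (hF k).2 X] at h1
    exact tendsto_nhds_unique h1 tendsto_const_nhds |>.symm ▸ rfl

theorem exists_subseq_tendsto {F : ℕ → Matrix n n ℂ →ₗ[ℂ] Matrix m m ℂ}
    (hF : ∀ k, IsChannel (F k)) :
    ∃ (G : Matrix n n ℂ →ₗ[ℂ] Matrix m m ℂ) (φ : ℕ → ℕ), IsChannel G ∧ StrictMono φ ∧
      TendstoMap (fun k => F (φ k)) G := by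
  choose C hC using fun x : n × n => exists_bound_channel (m := m) (Matrix.single x.1 x.2 (1 : ℂ))
  let v : ℕ → (n × n) → (m × m) → ℂ := fun k x y => F k (Matrix.single x.1 x.2 1) y.1 y.2
  have hb : Bornology.IsBounded (Set.range v) := by
    rw [isBounded_iff_forall_norm_le]
    refine ⟨∑ x, |C x|, ?_⟩
    rintro _ ⟨k, rfl⟩
    have h0 : 0 ≤ ∑ x, |C x| := Finset.sum_nonneg fun x _ => abs_nonneg _
    refine (pi_norm_le_iff_of_nonneg h0).mpr fun x => (pi_norm_le_iff_of_nonneg h0).mpr fun y => ?_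
    exact ((hC x (F k) (hF k) y.1 y.2).trans (le_abs_self _)).trans
      (Finset.single_le_sum (f := fun x => |C x|) (fun x _ => abs_nonneg _) (Finset.mem_univ x))
  obtain ⟨a, -, φ, hφ, hlim⟩ := tendsto_subseq_of_bounded hb (fun k => Set.mem_range_self k)
  let G : Matrix n n ℂ →ₗ[ℂ] Matrix m m ℂ :=
    { toFun := fun X => ∑ x : n × n, X x.1 x.2 • Matrix.of fun i j => a x (i, j)
      map_add' := fun X Y => by
        simp only [Matrix.add_apply, add_smul, Finset.sum_add_distrib]
      map_smul' := fun c X => by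
        simp only [Matrix.smul_apply, smul_eq_mul, mul_smul, Finset.smul_sum, RingHom.id_apply] }
  have hG : ∀ x y i j, G (Matrix.single x y 1) i j = a (x, y) (i, j) := fun x y i j => by
    simp only [G, LinearMap.coe_mk, AddHom.coe_mk, Matrix.sum_apply]
    rw [Finset.sum_eq_single (x, y)]
    · simp
    · rintro ⟨x', y'⟩ _ hne
      have : ¬ (x = x' ∧ y = y') := fun h => hne (by rw [h.1, h.2])
      simp [this]
    · simp
  have hT : TendstoMap (fun k => F (φ k)) G := by
    refine TendstoMap.of_single fun x y i j => ?_
    rw [hG]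
    exact tendsto_pi_nhds.mp (tendsto_pi_nhds.mp hlim (x, y)) (i, j)
  exact ⟨G, φ, hT.isChannel fun k => hF _, hφ, hT⟩

/-- Simultaneous extraction of convergent subsequences for two sequences of channels. -/
theorem exists_subseq_tendsto₂ {F : ℕ → Matrix n n ℂ →ₗ[ℂ] Matrix m m ℂ}
    {F' : ℕ → Matrix p p ℂ →ₗ[ℂ] Matrix q q ℂ}
    (hF : ∀ k, IsChannel (F k)) (hF' : ∀ k, IsChannel (F' k)) :
    ∃ (G : Matrix n n ℂ →ₗ[ℂ] Matrix m m ℂ) (G' : Matrix p p ℂ →ₗ[ℂ] Matrix q q ℂ) (φ : ℕ → ℕ),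
      IsChannel G ∧ IsChannel G' ∧ StrictMono φ ∧
      TendstoMap (fun k => F (φ k)) G ∧ TendstoMap (fun k => F' (φ k)) G' := by
  obtain ⟨G, φ, hG, hφ, hlim⟩ := exists_subseq_tendsto hF
  obtain ⟨G', ψ, hG', hψ, hlim'⟩ := exists_subseq_tendsto fun k => hF' (φ k)
  exact ⟨G, G', φ ∘ ψ, hG, hG', hφ.comp hψ, hlim.subseq hψ.tendsto_atTop, hlim'⟩

/-! ### The peripheral projection -/

/-- `P` is an idempotent limit of the powers of `T` along the sequence of exponents `g`. -/
structure IsPeripheralLimit (T P : Module.End ℂ (Matrix n n ℂ)) (g : ℕ → ℕ) : Prop where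
  le : ∀ k, k ≤ g k
  tendsto : TendstoMap (fun k => T ^ g k) P
  idem : P * P = P

theorem TendstoMap.pow_add {T A B : Module.End ℂ (Matrix n n ℂ)} {a b : ℕ → ℕ}
    (hA : TendstoMap (fun k => T ^ a k) A) (hB : TendstoMap (fun k => T ^ b k) B) :
    TendstoMap (fun k => T ^ (a k + b k)) (A * B) := by
  simp only [_root_.pow_add]
  exact hA.comp hB

/-- If `A` and `C` are limits of powers of `T` with `C * A ^ 2 = A`, then `C * A` is an
idempotent limit of powers. -/
theorem isPeripheralLimit_of_tendsto {T A C : Module.End ℂ (Matrix n n ℂ)} {a b : ℕ → ℕ}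
    (hb : ∀ k, k ≤ b k) (hA : TendstoMap (fun k => T ^ a k) A)
    (hC : TendstoMap (fun k => T ^ b k) C) (h : TendstoMap (fun k => T ^ (b k + a k + a k)) A) :
    IsPeripheralLimit T (C * A) (fun k => b k + a k) where
  le k := (hb k).trans (Nat.le_add_right _ _)
  tendsto := hC.pow_add hA
  idem := by
    have h1 : C * A * A = A := ((hC.pow_add hA).pow_add hA).unique h
    have h2 : A * C = C * A := by
      refine (hA.pow_add hC).unique ?_
      simpa only [add_comm] using hC.pow_add hA
    rw [mul_assoc, ← mul_assoc A, h2, h1]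

/-- Two channels have idempotent limits of powers along a common sequence of exponents. -/
theorem exists_isPeripheralLimit {T : Module.End ℂ (Matrix n n ℂ)}
    {S : Module.End ℂ (Matrix m m ℂ)} (hT : IsChannel T) (hS : IsChannel S) :
    ∃ P Q g, IsPeripheralLimit T P g ∧ IsPeripheralLimit S Q g := by
  -- With `A` the limit along `φ`, the exponents `φ (2 * φ k + k) - 2 * φ k` are chosen such that
  -- their limit `C` satisfies `C * A ^ 2 = A`; the summand `k` makes them tend to infinity.
  obtain ⟨A, A', φ, -, -, hφ, hA, hA'⟩ := exists_subseq_tendsto₂ (fun k => hT.pow k)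
    (fun k => hS.pow k)
  have hle : ∀ k, 2 * φ k + k ≤ φ (2 * φ k + k) := fun k => hφ.id_le _
  obtain ⟨C, C', θ, -, -, hθ, hC, hC'⟩ := exists_subseq_tendsto₂
    (fun k => hT.pow (φ (2 * φ k + k) - 2 * φ k)) (fun k => hS.pow (φ (2 * φ k + k) - 2 * φ k))
  have hb : ∀ k, k ≤ φ (2 * φ (θ k) + θ k) - 2 * φ (θ k) := fun k =>
    (hθ.id_le k).trans (Nat.le_sub_of_add_le (by rw [add_comm]; exact hle (θ k)))
  have heq : ∀ k, φ (2 * φ (θ k) + θ k) - 2 * φ (θ k) + φ (θ k) + φ (θ k)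
      = φ (2 * φ (θ k) + θ k) := fun k => by
    have := hle (θ k)
    omega
  have hlim : Tendsto (fun k => 2 * φ (θ k) + θ k) atTop atTop :=
    tendsto_atTop_mono (fun k => (hθ.id_le k).trans (Nat.le_add_left _ _)) tendsto_id
  refine ⟨C * A, C' * A', _, isPeripheralLimit_of_tendsto hb (hA.subseq hθ.tendsto_atTop) hC ?_,
    isPeripheralLimit_of_tendsto hb (hA'.subseq hθ.tendsto_atTop) hC' ?_⟩
  · simp only [heq]
    exact hA.subseq hlim
  · simp only [heq]
    exact hA'.subseq hlim

namespace IsPeripheralLimit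

variable {T P : Module.End ℂ (Matrix n n ℂ)} {S Q : Module.End ℂ (Matrix m m ℂ)} {g : ℕ → ℕ}

theorem tendsto_atTop (h : IsPeripheralLimit T P g) : Tendsto g atTop atTop :=
  tendsto_atTop_mono h.le tendsto_id

theorem isChannel (h : IsPeripheralLimit T P g) (hT : IsChannel T) : IsChannel P :=
  h.tendsto.isChannel fun _ => hT.pow _

theorem tensorMap_pow (T : Module.End ℂ (Matrix n n ℂ)) (S : Module.End ℂ (Matrix m m ℂ)) (k : ℕ) :
    (tensorMap T S : Module.End ℂ (Matrix (n × m) (n × m) ℂ)) ^ k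
      = tensorMap (T ^ k : Module.End ℂ (Matrix n n ℂ)) (S ^ k : Module.End ℂ (Matrix m m ℂ)) := by
  induction k with
  | zero =>
    refine linearMap_ext_kronecker fun A B => ?_
    rw [tensorMap_kronecker]
    simp
  | succ k ih =>
    refine linearMap_ext_kronecker fun A B => ?_
    rw [pow_succ, ih, Module.End.mul_apply, tensorMap_kronecker, tensorMap_kronecker,
      tensorMap_kronecker, pow_succ, pow_succ]
    rfl

theorem tensorMap (h : IsPeripheralLimit T P g) (h' : IsPeripheralLimit S Q g) :
    IsPeripheralLimit (tensorMap T S) (tensorMap P Q) g where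
  le := h.le
  tendsto := by
    simp only [tensorMap_pow]
    exact TendstoMap.tensorMap h.tendsto h'.tendsto
  idem := by
    refine linearMap_ext_kronecker fun A B => ?_
    rw [Module.End.mul_apply, tensorMap_kronecker, tensorMap_kronecker, ← Module.End.mul_apply,
      ← Module.End.mul_apply, h.idem, h'.idem]

/-- The peripheral projection factors through every power of the channel. -/
theorem exists_mul_pow (h : IsPeripheralLimit T P g) (hT : IsChannel T) (t : ℕ) :
    ∃ R : Module.End ℂ (Matrix n n ℂ), IsChannel R ∧ R * T ^ t = P := by
  obtain ⟨R, φ, hR, hφ, hlim⟩ := exists_subseq_tendsto fun k => hT.pow (g (k + t) - t)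
  refine ⟨R, hR, TendstoMap.unique (F := fun k => T ^ (g (φ k + t))) ?_ ?_⟩
  · have h1 : ∀ k, g (φ k + t) = g (φ k + t) - t + t := fun k => by
      have := h.le (φ k + t)
      omega
    simp only [fun k => congrArg (T ^ ·) (h1 k)]
    exact TendstoMap.pow_add hlim (b := fun _ => t) fun X => tendsto_const_nhds
  · exact h.tendsto.subseq (tendsto_atTop_mono
      (fun k => (hφ.id_le k).trans (Nat.le_add_right _ t)) tendsto_id)

end IsPeripheralLimit

end Limits

/-! ### The peripheral subspace -/

section Peripheral

variable {n m : Type*} [Fintype n] [DecidableEq n] [Fintype m] [DecidableEq m]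
variable {T P : Module.End ℂ (Matrix n n ℂ)} {S Q : Module.End ℂ (Matrix m m ℂ)} {g : ℕ → ℕ}

namespace IsPeripheralLimit

theorem commute (h : IsPeripheralLimit T P g) : Commute T P := by
  refine TendstoMap.unique (F := fun k => T ^ (g k + 1)) ?_ ?_
  · simp only [fun k => pow_succ' T (g k)]
    exact TendstoMap.comp (F' := fun _ => T) (fun _ => tendsto_const_nhds) h.tendsto
  · simp only [fun k => pow_succ T (g k)]
    exact TendstoMap.comp (F := fun _ => T) h.tendsto fun _ => tendsto_const_nhds

theorem tendsto_entry (h : IsPeripheralLimit T P g) {X : Matrix n n ℂ} (hX : P X = X) (i j : n) :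
    Tendsto (fun k => (T ^ g k) X i j) atTop (𝓝 (X i j)) := by
  have := h.tendsto.apply X i j
  rwa [hX] at this

theorem pow_apply_of_eigen {z : ℂ} {X : Matrix n n ℂ} (hz : T X = z • X) (k : ℕ) :
    (T ^ k) X = z ^ k • X := by
  induction k with
  | zero => simp
  | succ k ih => rw [pow_succ, Module.End.mul_apply, hz, map_smul, ih, smul_smul, pow_succ']

/-- Eigenvectors of `T` in the range of the peripheral projection have unimodular eigenvalues. -/
theorem norm_eq_one_of_eigen (h : IsPeripheralLimit T P g) {z : ℂ} {X : Matrix n n ℂ}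
    (hX : P X = X) (hz : T X = z • X) (hX0 : X ≠ 0) : ‖z‖ = 1 := by
  obtain ⟨i, j, hij⟩ : ∃ i j, X i j ≠ 0 := by
    by_contra! hcon
    exact hX0 (Matrix.ext hcon)
  have h1 := (h.tendsto_entry hX i j).norm
  simp only [pow_apply_of_eigen hz, Matrix.smul_apply, smul_eq_mul, norm_mul, norm_pow] at h1
  have hpos : 0 < ‖X i j‖ := norm_pos_iff.mpr hij
  rcases lt_trichotomy ‖z‖ 1 with hlt | heq | hgt
  · have h2 := ((tendsto_pow_atTop_nhds_zero_of_lt_one (norm_nonneg z) hlt).comp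
      h.tendsto_atTop).mul_const ‖X i j‖
    rw [zero_mul] at h2
    exact absurd (tendsto_nhds_unique h1 h2) hpos.ne'
  · exact heq
  · have h2 := ((tendsto_pow_atTop_atTop_of_one_lt hgt).comp h.tendsto_atTop).atTop_mul_const hpos
    exact absurd h1 (not_tendsto_nhds_of_tendsto_atTop h2 _)

/-- There are no Jordan blocks of size two in the range of the peripheral projection: they would
make the powers of `T` grow linearly. -/
theorem eigen_of_sq (h : IsPeripheralLimit T P g) {z : ℂ} {X : Matrix n n ℂ}
    (hX : P X = X) (hz : (T - algebraMap ℂ _ z) ((T - algebraMap ℂ _ z) X) = 0) :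
    (T - algebraMap ℂ _ z) X = 0 := by
  set Y := (T - algebraMap ℂ (Module.End ℂ (Matrix n n ℂ)) z) X with hY
  by_contra hY0
  have hTX : T X = z • X + Y := by
    rw [hY, LinearMap.sub_apply, Module.algebraMap_end_apply]
    abel
  have hTY : T Y = z • Y := by
    rw [LinearMap.sub_apply, Module.algebraMap_end_apply, sub_eq_zero] at hz
    exact hz
  have hPY : P Y = Y := by
    rw [hY, LinearMap.sub_apply, Module.algebraMap_end_apply, map_sub, map_smul, hX]
    have := LinearMap.congr_fun h.commute.eq X
    rw [Module.End.mul_apply, Module.End.mul_apply, hX] at this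
    rw [← this]
  have hz1 := h.norm_eq_one_of_eigen hPY hTY hY0
  have hz0 : z ≠ 0 := by
    rintro rfl
    simp at hz1
  have hpow : ∀ k : ℕ, (T ^ k) X = z ^ k • X + (k * z ^ k * z⁻¹) • Y := by
    intro k
    induction k with
    | zero => simp
    | succ k ih =>
      rw [pow_succ', Module.End.mul_apply, ih, map_add, map_smul, map_smul, hTX, hTY, smul_add,
        smul_smul, smul_smul, add_assoc, ← add_smul, pow_succ]
      congr 2
      push_cast
      field_simp
      ring
  obtain ⟨i, j, hij⟩ : ∃ i j, Y i j ≠ 0 := by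
    by_contra! hcon
    exact hY0 (Matrix.ext hcon)
  have hpos : 0 < ‖Y i j‖ := norm_pos_iff.mpr hij
  have h1 := (h.tendsto_entry hX i j).norm
  have h2 : Tendsto (fun k => (g k : ℝ) * ‖Y i j‖ - ‖X i j‖) atTop atTop :=
    tendsto_atTop_add_const_right _ _
      ((tendsto_natCast_atTop_atTop.comp h.tendsto_atTop).atTop_mul_const hpos)
  have h3 : ∀ k, (g k : ℝ) * ‖Y i j‖ - ‖X i j‖ ≤ ‖(T ^ g k) X i j‖ := fun k => by
    rw [hpow, Matrix.add_apply, Matrix.smul_apply, Matrix.smul_apply, smul_eq_mul, smul_eq_mul]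
    have h4 := norm_sub_le_norm_add (g k * z ^ g k * z⁻¹ * Y i j) (z ^ g k * X i j)
    rw [norm_mul, norm_mul, norm_mul, norm_mul, norm_pow, norm_inv, hz1, one_pow, inv_one, mul_one,
      mul_one, one_mul, Complex.norm_natCast] at h4
    rw [add_comm]
    exact h4
  exact not_tendsto_nhds_of_tendsto_atTop (tendsto_atTop_mono h3 h2) _ h1

/-- The range of the peripheral projection is contained in the peripheral subspace. -/
theorem apply_mem (h : IsPeripheralLimit T P g) (X : Matrix n n ℂ) :
    P X ∈ peripheralSubspace T := by
  have hX : X ∈ ⨆ z : ℂ, ⨆ k : ℕ, T.genEigenspace z k := by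
    have := Module.End.iSup_maxGenEigenspace_eq_top T
    simp only [← Module.End.iSup_genEigenspace_eq] at this
    rw [this]
    trivial
  have hPP : ∀ Y, P (P Y) = P Y := fun Y => LinearMap.congr_fun h.idem Y
  have hstep : ∀ (z : ℂ) (k : ℕ) (Y : Matrix n n ℂ), P Y = Y →
      ((T - algebraMap ℂ _ z) ^ (k + 1)) Y = 0 → (T - algebraMap ℂ _ z) Y = 0 := by
    intro z k
    have hcomm : Commute P (T - algebraMap ℂ _ z) :=
      h.commute.symm.sub_right (Algebra.commute_algebraMap_right z P)
    induction k with
    | zero => intro Y _ hY; simpa using hY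
    | succ k ih =>
      intro Y hPY hY
      rw [pow_succ, Module.End.mul_apply] at hY
      refine h.eigen_of_sq hPY (ih _ ?_ hY)
      have := LinearMap.congr_fun hcomm.eq Y
      rwa [Module.End.mul_apply, Module.End.mul_apply, hPY] at this
  induction hX using Submodule.iSup_induction' with
  | zero => rw [map_zero]; exact Submodule.zero_mem _
  | add x y _ _ hx hy => rw [map_add]; exact Submodule.add_mem _ hx hy
  | mem z x hx =>
    induction hx using Submodule.iSup_induction' with
    | zero => rw [map_zero]; exact Submodule.zero_mem _
    | add x y _ _ hx hy => rw [map_add]; exact Submodule.add_mem _ hx hy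
    | mem k x hx =>
      rw [Module.End.mem_genEigenspace_nat, LinearMap.mem_ker] at hx
      have hcomm : Commute P ((T - algebraMap ℂ _ z) ^ (k + 1)) :=
        (h.commute.symm.sub_right (Algebra.commute_algebraMap_right z P)).pow_right _
      have hx' : ((T - algebraMap ℂ _ z) ^ (k + 1)) (P x) = 0 := by
        have := LinearMap.congr_fun hcomm.eq x
        rw [Module.End.mul_apply, Module.End.mul_apply] at this
        rw [← this, pow_succ', Module.End.mul_apply]
        have hx2 : ((T - algebraMap ℂ (Module.End ℂ (Matrix n n ℂ)) z) ^ k) x = 0 := hx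
        rw [hx2, map_zero, map_zero]
      have h1 := hstep z k (P x) (hPP x) hx'
      rw [LinearMap.sub_apply, Module.algebraMap_end_apply, sub_eq_zero] at h1
      by_cases h0 : P x = 0
      · rw [h0]; exact Submodule.zero_mem _
      · exact Submodule.subset_span ⟨z, h.norm_eq_one_of_eigen (hPP x) h1 h0, h1⟩

/-- Eigenvectors with unimodular eigenvalue lie in the range of the peripheral projection. -/
theorem exists_apply_eq (h : IsPeripheralLimit T P g) {z : ℂ} {X : Matrix n n ℂ} (hz1 : ‖z‖ = 1)
    (hz : T X = z • X) : ∃ Y, P Y = X := by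
  by_cases hX0 : X = 0
  · exact ⟨0, by rw [hX0, map_zero]⟩
  obtain ⟨i, j, hij⟩ : ∃ i j, X i j ≠ 0 := by
    by_contra! hcon
    exact hX0 (Matrix.ext hcon)
  have h1 := h.tendsto X
  simp only [pow_apply_of_eigen hz] at h1
  have h2 : Tendsto (fun k => z ^ g k) atTop (𝓝 (P X i j / X i j)) := by
    have := (tendsto_matrix_iff.mp h1 i j).div_const (X i j)
    simpa [hij] using this
  set c := P X i j / X i j with hc
  have hcn : ‖c‖ = 1 := by
    have := h2.norm
    simp only [norm_pow, hz1, one_pow] at this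
    exact (tendsto_nhds_unique this tendsto_const_nhds)
  have hc0 : c ≠ 0 := by
    intro h
    rw [h, norm_zero] at hcn
    exact zero_ne_one hcn
  have h3 : P X = c • X := tendsto_nhds_unique h1 (h2.smul_const X)
  exact ⟨c⁻¹ • X, by rw [map_smul, h3, smul_smul, inv_mul_cancel₀ hc0, one_smul]⟩

end IsPeripheralLimit

theorem peripheralSubspace_tensorMap (h : IsPeripheralLimit T P g) (h' : IsPeripheralLimit S Q g) :
    peripheralSubspace (tensorMap T S) =
      Submodule.span ℂ (Set.image2 (fun A B => A ⊗ₖ B)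
        (peripheralSubspace T : Set (Matrix n n ℂ))
        (peripheralSubspace S : Set (Matrix m m ℂ))) := by
  apply le_antisymm
  · refine Submodule.span_le.mpr ?_
    rintro X ⟨z, hz1, hz⟩
    obtain ⟨Y, rfl⟩ := (h.tensorMap h').exists_apply_eq hz1 hz
    clear hz
    obtain ⟨y, rfl⟩ := (kroneckerLinearEquiv n n m m ℂ).surjective Y
    induction y using TensorProduct.induction_on with
    | zero => rw [map_zero, map_zero]; exact Submodule.zero_mem _
    | tmul A B =>
      rw [kroneckerLinearEquiv_tmul, tensorMap_kronecker]
      exact Submodule.subset_span ⟨P A, h.apply_mem A, Q B, h'.apply_mem B, rfl⟩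
    | add x y hx hy => rw [map_add, map_add]; exact Submodule.add_mem _ hx hy
  · refine Submodule.span_le.mpr ?_
    rintro _ ⟨A, hA, B, hB, rfl⟩
    refine Submodule.span_induction (p := fun A _ => A ⊗ₖ B ∈ peripheralSubspace (tensorMap T S))
      ?_ ?_ ?_ ?_ hA
    · rintro A ⟨z, hz1, hz⟩
      refine Submodule.span_induction
        (p := fun B _ => A ⊗ₖ B ∈ peripheralSubspace (tensorMap T S)) ?_ ?_ ?_ ?_ hB
      · rintro B ⟨w, hw1, hw⟩
        refine Submodule.subset_span ⟨z * w, by rw [norm_mul, hz1, hw1, one_mul], ?_⟩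
        rw [tensorMap_kronecker, hz, hw, Matrix.smul_kronecker, Matrix.kronecker_smul, smul_smul]
      · rw [Matrix.kronecker_zero]; exact Submodule.zero_mem _
      · intro x y _ _ hx hy
        rw [Matrix.kronecker_add]; exact Submodule.add_mem _ hx hy
      · intro c x _ hx
        rw [Matrix.kronecker_smul]; exact Submodule.smul_mem _ _ hx
    · rw [Matrix.zero_kronecker]; exact Submodule.zero_mem _
    · intro x y _ _ hx hy
      rw [Matrix.add_kronecker]; exact Submodule.add_mem _ hx hy
    · intro c x _ hx
      rw [Matrix.smul_kronecker]; exact Submodule.smul_mem _ _ hx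

end Peripheral

section Capacity

variable {n m κ μ ι ι' : Type*} [Fintype n] [DecidableEq n] [Fintype m] [DecidableEq m]
  [Fintype κ] [Fintype μ] [Fintype ι] [Fintype ι']

/-! ### Codes for all powers of a channel -/

/-- There are an encoder and a decoder of size `D` for `T` such that the composed channel satisfies
the criterion `good`. -/
def HasCode (good : ∀ D : ℕ, (Matrix (Fin D) (Fin D) ℂ →ₗ[ℂ] Matrix (Fin D) (Fin D) ℂ) → Prop)
    (T : Module.End ℂ (Matrix n n ℂ)) (D : ℕ) : Prop :=
  ∃ (E : Matrix (Fin D) (Fin D) ℂ →ₗ[ℂ] Matrix n n ℂ)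
    (R : Matrix n n ℂ →ₗ[ℂ] Matrix (Fin D) (Fin D) ℂ), IsChannel E ∧ IsChannel R ∧
    good D (R ∘ₗ T ∘ₗ E)

/-- The criterion for zero-error classical codes. -/
def ClassicalGood (D : ℕ) (F : Matrix (Fin D) (Fin D) ℂ →ₗ[ℂ] Matrix (Fin D) (Fin D) ℂ) : Prop :=
  1 - 0 ≤ averageFidelity F

/-- The criterion for zero-error quantum codes. -/
def QuantumGood (D : ℕ) (F : Matrix (Fin D) (Fin D) ℂ →ₗ[ℂ] Matrix (Fin D) (Fin D) ℂ) : Prop :=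
  1 - 0 ≤ entanglementFidelity F

/-- A criterion which is preserved under pointwise limits. -/
def IsClosedCriterion
    (good : ∀ D : ℕ, (Matrix (Fin D) (Fin D) ℂ →ₗ[ℂ] Matrix (Fin D) (Fin D) ℂ) → Prop) : Prop :=
  ∀ D F G, TendstoMap F G → (∀ k, good D (F k)) → good D G

theorem isClosedCriterion_classical : IsClosedCriterion ClassicalGood := by
  intro D F G h hF
  refine ge_of_tendsto' (x := atTop) (f := fun k => averageFidelity (F k)) ?_ hF
  refine Tendsto.const_mul _ (tendsto_finsetSum _ fun i _ => ?_)
  exact (Complex.continuous_re.tendsto _).comp (h.apply _ i i)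

theorem isClosedCriterion_quantum : IsClosedCriterion QuantumGood := by
  intro D F G h hF
  refine ge_of_tendsto' (x := atTop) (f := fun k => entanglementFidelity (F k)) ?_ hF
  simp only [entanglementFidelity_eq]
  refine Tendsto.div_const ((Complex.continuous_re.tendsto _).comp ?_) _
  exact tendsto_finsetSum _ fun a _ => tendsto_finsetSum _ fun b _ => h.apply _ a b

variable {good : ∀ D : ℕ, (Matrix (Fin D) (Fin D) ℂ →ₗ[ℂ] Matrix (Fin D) (Fin D) ℂ) → Prop}
  {T P : Module.End ℂ (Matrix n n ℂ)} {S Q : Module.End ℂ (Matrix m m ℂ)} {g : ℕ → ℕ}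

theorem HasCode.of_mul {A B : Module.End ℂ (Matrix n n ℂ)} {D : ℕ} (hA : IsChannel A)
    (h : HasCode good (A * B) D) : HasCode good B D := by
  obtain ⟨E, R, hE, hR, hg⟩ := h
  exact ⟨E, R ∘ₗ A, hE, hR.comp hA, hg⟩

theorem HasCode.antitone_pow (hT : IsChannel T) {D s t : ℕ} (hst : s ≤ t)
    (h : HasCode good (T ^ t) D) : HasCode good (T ^ s) D := by
  rw [← Nat.sub_add_cancel hst, pow_add] at h
  exact h.of_mul (hT.pow _)

/-- By compactness, codes for all powers of a channel converge to a code for the peripheral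
projection. -/
theorem IsPeripheralLimit.hasCode (h : IsPeripheralLimit T P g) (hgood : IsClosedCriterion good)
    {D : ℕ} (hcode : ∀ t, HasCode good (T ^ t) D) : HasCode good P D := by
  choose E R hE hR hER using fun k => hcode (g k)
  obtain ⟨E', φ, hE', hφ, hlimE⟩ := exists_subseq_tendsto hE
  obtain ⟨R', ψ, hR', hψ, hlimR⟩ := exists_subseq_tendsto fun k => hR (φ k)
  refine ⟨E', R', hE', hR', hgood D (fun k => R (φ (ψ k)) ∘ₗ (T ^ g (φ (ψ k))) ∘ₗ E (φ (ψ k))) _ ?_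
    fun k => hER _⟩
  exact hlimR.comp ((h.tendsto.subseq (hφ.comp hψ).tendsto_atTop).comp
    (hlimE.subseq hψ.tendsto_atTop))

/-- If `N` is the largest size of a code for the peripheral projection, then it is the largest size
of a code for all large powers of the channel. -/
theorem IsPeripheralLimit.eventually_maximal (h : IsPeripheralLimit T P g) (hT : IsChannel T)
    (hgood : IsClosedCriterion good) {N B : ℕ} (hN : HasCode good P N)
    (hmax : ∀ D, 1 ≤ D → HasCode good P D → D ≤ N)
    (hB : ∀ D, 1 ≤ D → HasCode good (1 : Module.End ℂ (Matrix n n ℂ)) D → D ≤ B) :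
    ∀ᶠ t in atTop, HasCode good (T ^ t) N ∧ ∀ D, 1 ≤ D → HasCode good (T ^ t) D → D ≤ N := by
  have hlarge : ∀ D ∈ Finset.Icc 1 B, ∀ᶠ t in atTop, HasCode good (T ^ t) D → D ≤ N := by
    intro D hD
    by_cases hDN : D ≤ N
    · exact Eventually.of_forall fun _ _ => hDN
    · obtain ⟨t, ht⟩ : ∃ t, ¬ HasCode good (T ^ t) D := by
        by_contra! hcon
        exact hDN (hmax D (Finset.mem_Icc.mp hD).1 (h.hasCode hgood hcon))
      filter_upwards [eventually_ge_atTop t] with s hs hcode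
      exact absurd (hcode.antitone_pow hT hs) ht
  filter_upwards [(Filter.eventually_all_finset _).mpr hlarge] with t ht
  refine ⟨?_, fun D hD hcode => ?_⟩
  · obtain ⟨R, hR, hRP⟩ := h.exists_mul_pow hT t
    rw [← hRP] at hN
    exact hN.of_mul hR
  · refine ht D (Finset.mem_Icc.mpr ⟨hD, hB D hD ?_⟩) hcode
    rw [← pow_zero T]
    exact hcode.antitone_pow hT (Nat.zero_le t)

theorem classicalCapacity_eq {N : ℕ} (hN : 1 ≤ N) (hcode : HasCode ClassicalGood T N)
    (hmax : ∀ D, 1 ≤ D → HasCode ClassicalGood T D → D ≤ N) :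
    classicalCapacity 0 T = ((Real.logb 2 N : ℝ) : EReal) := by
  apply le_antisymm
  · refine iSup_le fun D => iSup_le fun hD => iSup_le fun E => iSup_le fun hE => ?_
    obtain ⟨hE, R, hR, hg⟩ := hE
    have hDN := hmax D hD ⟨E, R, hE, hR, hg⟩
    exact EReal.coe_le_coe_iff.mpr (Real.logb_le_logb_of_le (by norm_num)
      (by exact_mod_cast hD) (by exact_mod_cast hDN))
  · obtain ⟨E, R, hE, hR, hg⟩ := hcode
    exact le_iSup_of_le N (le_iSup_of_le hN (le_iSup_of_le E
      (le_iSup_of_le ⟨hE, R, hR, hg⟩ le_rfl)))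

theorem quantumCapacity_eq {N : ℕ} (hN : 1 ≤ N) (hcode : HasCode QuantumGood T N)
    (hmax : ∀ D, 1 ≤ D → HasCode QuantumGood T D → D ≤ N) :
    quantumCapacity 0 T = ((Real.logb 2 N : ℝ) : EReal) := by
  apply le_antisymm
  · refine iSup_le fun D => iSup_le fun hD => iSup_le fun E => iSup_le fun hE => ?_
    obtain ⟨hE, R, hR, hg⟩ := hE
    have hDN := hmax D hD ⟨E, R, hE, hR, hg⟩
    exact EReal.coe_le_coe_iff.mpr (Real.logb_le_logb_of_le (by norm_num)
      (by exact_mod_cast hD) (by exact_mod_cast hDN))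
  · obtain ⟨E, R, hE, hR, hg⟩ := hcode
    exact le_iSup_of_le N (le_iSup_of_le hN (le_iSup_of_le E
      (le_iSup_of_le ⟨hE, R, hR, hg⟩ le_rfl)))

/-! ### The infinite-time capacities in terms of minimal projections -/

section ClassSize

variable {A : Type*} [Ring A] [Algebra ℂ A] [StarRing A] [StarModule ℂ A]

open Classical in
/-- The largest number of minimal projections of a decomposition in the same simple summand. -/
noncomputable def maxClassCard (e : ι → A) : ℕ :=
  Finset.univ.sup fun i => (Finset.univ.filter fun k => Linked (e k) (e i)).card

open Classical in
theorem exists_card_eq_maxClassCard [Nonempty ι] (e : ι → A) : ∃ i,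
    (Finset.univ.filter fun k => Linked (e k) (e i)).card = maxClassCard e := by
  obtain ⟨i, -, hi⟩ := Finset.exists_mem_eq_sup Finset.univ Finset.univ_nonempty
    fun i => (Finset.univ.filter fun k => Linked (e k) (e i)).card
  exact ⟨i, hi.symm⟩

open Classical in
theorem card_le_maxClassCard (e : ι → A) (i : ι) :
    (Finset.univ.filter fun k => Linked (e k) (e i)).card ≤ maxClassCard e :=
  Finset.le_sup (f := fun i => (Finset.univ.filter fun k => Linked (e k) (e i)).card)
    (Finset.mem_univ i)

theorem IsMinimalDecomposition.one_le_maxClassCard [Nonempty ι] {e : ι → A}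
    (he : IsMinimalDecomposition e) : 1 ≤ maxClassCard e := by
  classical
  obtain ⟨i⟩ := ‹Nonempty ι›
  refine le_trans (Finset.card_pos.mpr ⟨i, ?_⟩) (card_le_maxClassCard e i)
  simpa using he.linked_refl i

theorem IsAlgebraTensor.maxClassCard_eq {B C : Type*} [Ring B] [Algebra ℂ B] [StarRing B]
    [StarModule ℂ B] [Ring C] [Algebra ℂ C] [StarRing C] [StarModule ℂ C]
    {t : A →ₗ[ℂ] B →ₗ[ℂ] C} (ht : IsAlgebraTensor t) [Nonempty ι] [Nonempty ι']
    (e : ι → A) (f : ι' → B) :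
    maxClassCard (fun i : ι × ι' => t (e i.1) (f i.2)) = maxClassCard e * maxClassCard f := by
  classical
  have hcard : ∀ i : ι × ι', (Finset.univ.filter fun k : ι × ι' =>
      Linked (t (e k.1) (f k.2)) (t (e i.1) (f i.2))).card
      = (Finset.univ.filter fun k => Linked (e k) (e i.1)).card
        * (Finset.univ.filter fun k => Linked (f k) (f i.2)).card := by
    intro i
    rw [← Finset.card_product, ← Finset.filter_product, Finset.univ_product_univ]
    simp only [ht.linked_iff]
  apply le_antisymm
  · refine Finset.sup_le fun i _ => ?_
    rw [hcard]
    exact Nat.mul_le_mul (card_le_maxClassCard e i.1) (card_le_maxClassCard f i.2)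
  · obtain ⟨i, hi⟩ := exists_card_eq_maxClassCard e
    obtain ⟨j, hj⟩ := exists_card_eq_maxClassCard f
    rw [← hi, ← hj, ← hcard (i, j)]
    exact card_le_maxClassCard (fun i : ι × ι' => t (e i.1) (f i.2)) (i, j)

end ClassSize

variable {K : κ → Matrix n n ℂ} {hK : IsRetraction K} {e : ι → FixedAlgebra hK}

theorem IsMinimalDecomposition.nonempty [Nonempty n] (he : IsMinimalDecomposition e) :
    Nonempty ι := by
  by_contra h
  rw [not_nonempty_iff] at h
  have h1 := congrArg FixedAlgebra.val he.sum_eq_one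
  rw [Finset.univ_eq_empty, Finset.sum_empty, map_zero, FixedAlgebra.val_one] at h1
  exact zero_ne_one h1

theorem IsMinimalDecomposition.le_card_of_hasCode (he : IsMinimalDecomposition e) {D : ℕ}
    (h : HasCode ClassicalGood (kraus K) D) : D ≤ Fintype.card ι := by
  obtain ⟨E, R, hE, hR, hg⟩ := h
  exact he.classical_le hE hR hg

theorem IsMinimalDecomposition.le_maxClassCard_of_hasCode (he : IsMinimalDecomposition e) {D : ℕ}
    (hD : 1 ≤ D) (h : HasCode QuantumGood (kraus K) D) : D ≤ maxClassCard e := by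
  classical
  obtain ⟨E, R, hE, hR, hg⟩ := h
  obtain ⟨i, hi⟩ := he.quantum_le hD hE hR hg
  refine hi.trans (le_trans (le_of_eq ?_) (card_le_maxClassCard e i))
  congr

theorem IsMinimalDecomposition.hasCode_classical [Nonempty ι] (he : IsMinimalDecomposition e) :
    HasCode ClassicalGood (kraus K) (Fintype.card ι) :=
  he.exists_classicalCode Fintype.card_pos (Fintype.equivFin ι).symm

theorem IsMinimalDecomposition.hasCode_quantum [Nonempty ι] (he : IsMinimalDecomposition e) :
    HasCode QuantumGood (kraus K) (maxClassCard e) := by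
  classical
  obtain ⟨i, hi⟩ := exists_card_eq_maxClassCard e
  let f := (Finset.equivFinOfCardEq hi).symm
  exact he.exists_quantumCode he.one_le_maxClassCard i (fun k => (f k : ι))
    (fun k l h => f.injective (Subtype.ext h)) fun k => (Finset.mem_filter.mp (f k).2).2

/-- The sizes of the zero-error codes of the identity channel are bounded. -/
theorem exists_bound_hasCode_one (n : Type*) [Fintype n] [DecidableEq n] : ∃ B : ℕ, ∀ D, 1 ≤ D →
    (HasCode ClassicalGood (1 : Module.End ℂ (Matrix n n ℂ)) D ∨
      HasCode QuantumGood (1 : Module.End ℂ (Matrix n n ℂ)) D) → D ≤ B := by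
  have hid : IsRetraction (fun _ : Unit => (1 : Matrix n n ℂ)) :=
    ⟨by simp, fun X => by simp [kraus_one_eq_id]⟩
  have h1 : (1 : Module.End ℂ (Matrix n n ℂ)) = kraus (fun _ : Unit => (1 : Matrix n n ℂ)) :=
    kraus_one_eq_id.symm
  obtain ⟨N, e, he⟩ :=
    (FixedAlgebra.isFaithfulPositive_traceForm (hK := hid)).exists_minimalDecomposition
  refine ⟨max (Fintype.card (Fin N)) (maxClassCard e), fun D hD h => ?_⟩
  rw [h1] at h
  rcases h with h | h
  · exact (he.le_card_of_hasCode h).trans (le_max_left _ _)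
  · exact (he.le_maxClassCard_of_hasCode hD h).trans (le_max_right _ _)

/-- For large times, the zero-error classical capacity is the logarithm of the number of minimal
projections of the Choi–Effros algebra. -/
theorem IsPeripheralLimit.tendsto_classicalCapacity (hT : IsChannel T)
    (h : IsPeripheralLimit T (kraus K) g) (he : IsMinimalDecomposition e) [Nonempty ι] :
    Tendsto (fun t : ℕ => classicalCapacity 0 (T ^ t)) atTop
      (𝓝 ((Real.logb 2 (Fintype.card ι) : ℝ) : EReal)) := by
  obtain ⟨B, hB⟩ := exists_bound_hasCode_one n
  refine tendsto_const_nhds.congr' ?_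
  filter_upwards [h.eventually_maximal hT isClosedCriterion_classical he.hasCode_classical
    (fun D _ => he.le_card_of_hasCode) fun D hD hc => hB D hD (Or.inl hc)] with t ht
  exact (classicalCapacity_eq Fintype.card_pos ht.1 ht.2).symm

/-- For large times, the zero-error quantum capacity is the logarithm of the size of the largest
simple summand of the Choi–Effros algebra. -/
theorem IsPeripheralLimit.tendsto_quantumCapacity (hT : IsChannel T)
    (h : IsPeripheralLimit T (kraus K) g) (he : IsMinimalDecomposition e) [Nonempty ι] :
    Tendsto (fun t : ℕ => quantumCapacity 0 (T ^ t)) atTop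
      (𝓝 ((Real.logb 2 (maxClassCard e) : ℝ) : EReal)) := by
  obtain ⟨B, hB⟩ := exists_bound_hasCode_one n
  refine tendsto_const_nhds.congr' ?_
  filter_upwards [h.eventually_maximal hT isClosedCriterion_quantum he.hasCode_quantum
    (fun D hD => he.le_maxClassCard_of_hasCode hD) fun D hD hc => hB D hD (Or.inr hc)] with t ht
  exact (quantumCapacity_eq he.one_le_maxClassCard ht.1 ht.2).symm

theorem IsPeripheralLimit.exists_retraction (hT : IsChannel T) (h : IsPeripheralLimit T P g) :
    ∃ K : (Fin (Fintype.card n) × n) → Matrix n n ℂ, P = kraus K ∧ IsRetraction K := by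
  obtain ⟨K, rfl, hK⟩ := (h.isChannel hT).exists_kraus
  exact ⟨K, rfl, hK, fun X => LinearMap.congr_fun h.idem X⟩

end Capacity

end InfiniteTime

theorem theorem2 {n m : Type*} [Fintype n] [DecidableEq n] [Nonempty n]
    [Fintype m] [DecidableEq m] [Nonempty m]
    (T : Module.End ℂ (Matrix n n ℂ)) (S : Module.End ℂ (Matrix m m ℂ))
    (hT : InfiniteTime.IsChannel T) (hS : InfiniteTime.IsChannel S) :
    -- the limits defining the classical capacities exist and are finite
    (∃ c : ℝ, Tendsto (fun t : ℕ => InfiniteTime.classicalCapacity 0 (T ^ t)) atTop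
      (𝓝 (c : EReal))) ∧
    (∃ c : ℝ, Tendsto (fun t : ℕ => InfiniteTime.classicalCapacity 0 (S ^ t)) atTop
      (𝓝 (c : EReal))) ∧
    (∃ c : ℝ, Tendsto
      (fun t : ℕ => InfiniteTime.classicalCapacity 0 (InfiniteTime.tensorMap T S ^ t)) atTop
      (𝓝 (c : EReal))) ∧
    -- the limits defining the quantum capacities exist and are finite
    (∃ q : ℝ, Tendsto (fun t : ℕ => InfiniteTime.quantumCapacity 0 (T ^ t)) atTop
      (𝓝 (q : EReal))) ∧
    (∃ q : ℝ, Tendsto (fun t : ℕ => InfiniteTime.quantumCapacity 0 (S ^ t)) atTop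
      (𝓝 (q : EReal))) ∧
    (∃ q : ℝ, Tendsto
      (fun t : ℕ => InfiniteTime.quantumCapacity 0 (InfiniteTime.tensorMap T S ^ t)) atTop
      (𝓝 (q : EReal))) ∧
    -- additivity
    InfiniteTime.infClassicalCapacity 0 (InfiniteTime.tensorMap T S) =
      InfiniteTime.infClassicalCapacity 0 T + InfiniteTime.infClassicalCapacity 0 S ∧
    InfiniteTime.infQuantumCapacity 0 (InfiniteTime.tensorMap T S) =
      InfiniteTime.infQuantumCapacity 0 T + InfiniteTime.infQuantumCapacity 0 S ∧
    -- the peripheral subspace of the tensor product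
    InfiniteTime.peripheralSubspace (InfiniteTime.tensorMap T S) =
      Submodule.span ℂ (Set.image2 (fun A B => A ⊗ₖ B)
        (InfiniteTime.peripheralSubspace T : Set (Matrix n n ℂ))
        (InfiniteTime.peripheralSubspace S : Set (Matrix m m ℂ))) := by
  open InfiniteTime in
  obtain ⟨P, Q, g, hP, hQ⟩ := exists_isPeripheralLimit hT hS
  obtain ⟨K, rfl, hK⟩ := hP.exists_retraction hT
  obtain ⟨L, rfl, hL⟩ := hQ.exists_retraction hS
  have hPQ := hP.tensorMap hQ
  rw [tensorMap_kraus] at hPQ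
  obtain ⟨N, e, he⟩ :=
    (FixedAlgebra.isFaithfulPositive_traceForm (hK := hK)).exists_minimalDecomposition
  obtain ⟨M, f, hf⟩ :=
    (FixedAlgebra.isFaithfulPositive_traceForm (hK := hL)).exists_minimalDecomposition
  have := he.nonempty
  have := hf.nonempty
  have ht := FixedAlgebra.isAlgebraTensor hK hL
  have hef := ht.isMinimalDecomposition he hf
  have hTS := hT.tensorMap hS
  have hcT := hP.tendsto_classicalCapacity hT he
  have hcS := hQ.tendsto_classicalCapacity hS hf
  have hcTS := hPQ.tendsto_classicalCapacity hTS hef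
  have hqT := hP.tendsto_quantumCapacity hT he
  have hqS := hQ.tendsto_quantumCapacity hS hf
  have hqTS := hPQ.tendsto_quantumCapacity hTS hef
  have hpos : ∀ k : ℕ, 1 ≤ k → (k : ℝ) ≠ 0 := fun k hk => by positivity
  refine ⟨⟨_, hcT⟩, ⟨_, hcS⟩, ⟨_, hcTS⟩, ⟨_, hqT⟩, ⟨_, hqS⟩, ⟨_, hqTS⟩, ?_, ?_,
    peripheralSubspace_tensorMap hP hQ⟩
  · rw [infClassicalCapacity, infClassicalCapacity, infClassicalCapacity, hcT.limUnder_eq,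
      hcS.limUnder_eq, hcTS.limUnder_eq, Fintype.card_prod, Nat.cast_mul,
      Real.logb_mul (hpos _ Fintype.card_pos) (hpos _ Fintype.card_pos), EReal.coe_add]
  · rw [infQuantumCapacity, infQuantumCapacity, infQuantumCapacity, hqT.limUnder_eq,
      hqS.limUnder_eq, hqTS.limUnder_eq, ht.maxClassCard_eq, Nat.cast_mul,
      Real.logb_mul (hpos _ he.one_le_maxClassCard) (hpos _ hf.one_le_maxClassCard), EReal.coe_add]
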